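/- Let $M$ be a smooth manifold of dimension $2n+1$ and $(M,\lambda,J)$ a contact triad: $\lambda$ is a contact form with $\xi=\ker\lambda$ and Reeb vector field $R_\lambda$, and $J$ is a smooth endomorphism of $TM$ with $JR_\lambda=0$, $J\xi\subset\xi$, $J^2=-1$ on $\xi$, such that $d\lambda(\cdot,J\cdot)$ is symmetric and positive definite on $\xi$. Let $g=d\lambda(\cdot,J\cdot)+\lambda\otimes\lambda$ be the triad metric. Let $\varphi:M\to\mathbb R$ be a smooth function and $U\subset M$ an open set (for instance $U=M$, or the complement of a compact set when $\varphi$ is only assumed to be well behaved at infinity) such that: * $\varphi$ is $\lambda$-tame on $U$: $\mathcal L_{R_\lambda}d\varphi=0$ on $U$; * $\varphi$ is contact $J$-convex on $U$: on $U$ one has $-d(d\varphi\circ J)(v,Jv)\ge 0$ for all $v\in\xi$, and $R_\lambda\rfloor d(d\varphi\circ J)=0$. Let $\Lambda\subset M$ be a Legendrian submanifold, i.e. an embedded $n$-dimensional submanifold tangent to $\xi$ (possibly non-compact and with several components), such that the triple $(\Lambda,\varphi,J)$ is tame on $U$: the gradient of $\varphi$ with respect to $g$ is tangent to $\Lambda$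 at every point of $\Lambda\cap U$ (equivalently, $d\varphi\circ J$ vanishes on $T\Lambda$ and $d\varphi(R_\lambda)=0$ at these points). Let $(\dot\Sigma,j)$ be a Riemann surface with (possibly empty) boundary, for example a compact one with some boundary points removed, and let $w:(\dot\Sigma,\partial\dot\Sigma)\to(M,\Lambda)$ be a contact instanton, i.e. a smooth map, with $w(\partial\dot\Sigma)\subset\Lambda$, such that $$\pi\circ dw\circ j=J\circ\pi\circ dw,\qquad d(w^*\lambda\circ j)=0,$$ where $\pi:TM\to\xi$ is the projection along $R_\lambda$. Then: 1. $\varphi\circ w$ is subharmonic on $w^{-1}(U)$: $\Delta(\varphi\circ w)\ge 0$ there, in every holomorphic coordinate (equivalently, for the Laplacian of any metric compatible with $j$), including at boundary points. 2. At every $z\in\partial\dot\Sigma$ with $w(z)\in U$ the normal derivative of $\varphi\circ w$ vanishes: $d(\varphi\circ w)(jv)=0$ for all $v\in T_z\partial\dot\Sigma$. 3. $\varphi\circ w$ satisfies the strong maximum principle along $\partial\dot\Sigma$: if $\varphi\circ w$ has a local maximum at a point $z\in\partial\dot\Sigma$ with $w(z)\in U$, then it is constant near $z$; and if $\Omega\subset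 w^{-1}(U)$ is a connected open subset of $\dot\Sigma$ and the restriction of $\varphi\circ w$ to $\Omega$ attains its maximum at a point of $\Omega\cap\partial\dot\Sigma$, then $\varphi\circ w$ is constant on $\Omega$. -/

import Mathlib

open Set Filter Manifold Bundle InnerProductSpace
open scoped Topology ContDiff

noncomputable section

namespace ContactInstanton

section Forms

variable {E : Type*} [NormedAddCommGroup E] [NormedSpace ℝ E]
  {H : Type*} [TopologicalSpace H] (I : ModelWithCorners ℝ E H)
  {M : Type*} [TopologicalSpace M] [ChartedSpace H M]

variable (M) in
/-- A (not necessarily smooth) one-form on `M`. -/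
abbrev OneForm := ∀ p : M, TangentSpace I p →L[ℝ] ℝ

variable (M) in
/-- A (not necessarily smooth) field of endomorphisms of the tangent spaces of `M`. -/
abbrev EndField := ∀ p : M, TangentSpace I p →L[ℝ] TangentSpace I p

/-- Smoothness of a one-form, as a section of the bundle `Hom(TM, ℝ)`. -/
def OneForm.IsSmooth [IsManifold I ∞ M] (α : OneForm I M) : Prop :=
  ContMDiff I (I.prod 𝓘(ℝ, E →L[ℝ] ℝ)) ∞
    (fun p => TotalSpace.mk' (E →L[ℝ] ℝ)
      (E := fun p : M => TangentSpace I p →L[ℝ] Bundle.Trivial M ℝ p) p (α p))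

/-- Smoothness of a field of endomorphisms, as a section of the bundle `Hom(TM, TM)`. -/
def EndField.IsSmooth [IsManifold I ∞ M] (A : EndField I M) : Prop :=
  ContMDiff I (I.prod 𝓘(ℝ, E →L[ℝ] E)) ∞
    (fun p => TotalSpace.mk' (E →L[ℝ] E)
      (E := fun p : M => TangentSpace I p →L[ℝ] TangentSpace I p) p (A p))

/-- Smoothness of a vector field, as a section of `TM`. -/
def IsSmoothVectorField [IsManifold I ∞ M] (X : ∀ p : M, TangentSpace I p) : Prop :=
  ContMDiff I I.tangent ∞ (fun p => (TotalSpace.mk' E p (X p) : TangentBundle I M))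

/-- The one-form `α` read in the preferred chart at `p`: its value at the point `y` of the
model vector space is `(ψ^* α)_y`, where `ψ` is the inverse of the chart. -/
def OneForm.inChart (α : OneForm I M) (p : M) (y : E) : E →L[ℝ] ℝ :=
  (α ((extChartAt I p).symm y)).comp
    (mfderivWithin 𝓘(ℝ, E) I (extChartAt I p).symm (range I) y)

/-- The exterior derivative of a one-form, `dα (u, v) = D_u α (v) - D_v α (u)` computed in the
chart at `p` (with one-sided derivatives at boundary points). -/
def OneForm.d (α : OneForm I M) (p : M) (u v : TangentSpace I p) : ℝ :=
  let c : TangentSpace I p →L[ℝ] E := mfderiv I 𝓘(ℝ, E) (extChartAt I p) p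
  let D : E →L[ℝ] E →L[ℝ] ℝ :=
    fderivWithin ℝ (OneForm.inChart I α p) (range I) (extChartAt I p p)
  D (c u) (c v) - D (c v) (c u)

/-- The differential of a function, as a one-form. -/
def differential (f : M → ℝ) : OneForm I M := fun p => mfderiv I 𝓘(ℝ, ℝ) f p

/-- The Lie derivative `L_X α = X ⌟ dα + d(α(X))` of a one-form along a vector field. -/
def lieDeriv (X : ∀ p : M, TangentSpace I p) (α : OneForm I M) (p : M)
    (v : TangentSpace I p) : ℝ :=
  OneForm.d I α p (X p) v + differential I (fun q => α q (X q)) p v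

/-- The one-form `α ∘ A`. -/
def OneForm.compEnd (α : OneForm I M) (A : EndField I M) : OneForm I M :=
  fun p => (α p).comp (A p)

end Forms

section Contact

variable {n : ℕ} {M : Type*} [TopologicalSpace M]
  [ChartedSpace (EuclideanSpace ℝ (Fin (2 * n + 1))) M] [IsManifold (𝓡 (2 * n + 1)) ∞ M]

/-- `lam` is a contact form: a smooth one-form without zeros such that `d lam` is nondegenerate
on the hyperplanes `ξ = ker lam`; equivalently `lam ∧ (d lam)^n` is a volume form. -/
structure IsContactForm (lam : OneForm (𝓡 (2 * n + 1)) M) : Prop where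
  smooth : lam.IsSmooth
  ne_zero : ∀ p, lam p ≠ 0
  nondegenerate : ∀ p, ∀ v : TangentSpace (𝓡 (2 * n + 1)) p, lam p v = 0 →
    (∀ u : TangentSpace (𝓡 (2 * n + 1)) p, lam p u = 0 → lam.d _ p v u = 0) → v = 0

/-- `R` is the Reeb vector field of `lam`: `lam(R) = 1` and `R ⌟ d lam = 0`. -/
structure IsReebField (lam : OneForm (𝓡 (2 * n + 1)) M)
    (R : ∀ p : M, TangentSpace (𝓡 (2 * n + 1)) p) : Prop where
  smooth : IsSmoothVectorField (𝓡 (2 * n + 1)) R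
  apply_eq_one : ∀ p, lam p (R p) = 1
  d_eq_zero : ∀ p v, lam.d _ p (R p) v = 0

/-- `J` is a `lam`-adapted CR almost complex structure: `J` preserves `ξ = ker lam`,
`J² = -1` on `ξ`, `d lam(·, J ·)` is symmetric and positive definite on `ξ`, and `J` is
extended to `TM` by `J R = 0`. -/
structure IsAdapted (lam : OneForm (𝓡 (2 * n + 1)) M)
    (R : ∀ p : M, TangentSpace (𝓡 (2 * n + 1)) p) (J : EndField (𝓡 (2 * n + 1)) M) : Prop where
  smooth : J.IsSmooth
  apply_reeb : ∀ p, J p (R p) = 0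
  mapsTo : ∀ p v, lam p v = 0 → lam p (J p v) = 0
  sq : ∀ p v, lam p v = 0 → J p (J p v) = -v
  invariant : ∀ p u v, lam p u = 0 → lam p v = 0 →
    lam.d _ p (J p u) (J p v) = lam.d _ p u v
  pos : ∀ p v, lam p v = 0 → v ≠ 0 → 0 < lam.d _ p v (J p v)

variable (n M) in
/-- A contact triad `(M, lam, J)`, together with the (unique) Reeb vector field `R` of `lam`. -/
structure ContactTriad where
  lam : OneForm (𝓡 (2 * n + 1)) M
  R : ∀ p : M, TangentSpace (𝓡 (2 * n + 1)) p
  J : EndField (𝓡 (2 * n + 1)) M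
  isContactForm : IsContactForm lam
  isReebField : IsReebField lam R
  isAdapted : IsAdapted lam R J

variable (T : ContactTriad n M)

/-- The projection `π : TM → ξ` along the Reeb vector field. -/
def ContactTriad.proj (p : M) (v : TangentSpace (𝓡 (2 * n + 1)) p) :
    TangentSpace (𝓡 (2 * n + 1)) p :=
  v - T.lam p v • T.R p

/-- The triad metric `g = d lam(·, J ·) + lam ⊗ lam`. -/
def ContactTriad.metric (p : M) (u v : TangentSpace (𝓡 (2 * n + 1)) p) : ℝ :=
  T.lam.d _ p u (T.J p v) + T.lam p u * T.lam p v

/-- `φ` is `lam`-tame on `U`: the Lie derivative of `dφ` along the Reeb field vanishes on `U`. -/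
def IsTameOn (φ : M → ℝ) (U : Set M) : Prop :=
  ∀ p ∈ U, ∀ v, lieDeriv (𝓡 (2 * n + 1)) T.R (differential (𝓡 (2 * n + 1)) φ) p v = 0

/-- `φ` is contact `J`-convex on `U`: `-d(dφ ∘ J) ≥ 0` on `ξ` and `R ⌟ d(dφ ∘ J) = 0`. -/
structure IsContactConvexOn (φ : M → ℝ) (U : Set M) : Prop where
  nonneg : ∀ p ∈ U, ∀ v, T.lam p v = 0 →
    0 ≤ -((differential (𝓡 (2 * n + 1)) φ).compEnd _ T.J).d _ p v (T.J p v)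
  reeb : ∀ p ∈ U, ∀ v, ((differential (𝓡 (2 * n + 1)) φ).compEnd _ T.J).d _ p (T.R p) v = 0

variable {L : Type*} [TopologicalSpace L] [ChartedSpace (EuclideanSpace ℝ (Fin n)) L]

/-- `ι : L → M` is a Legendrian submanifold: an `n`-dimensional smoothly embedded submanifold
(of any number of components, compact or not) tangent to `ξ`. -/
structure IsLegendrian (ι : L → M) : Prop where
  embedding : IsSmoothEmbedding (𝓡 n) (𝓡 (2 * n + 1)) ∞ ι
  tangent : ∀ q v, T.lam (ι q) (mfderiv (𝓡 n) (𝓡 (2 * n + 1)) ι q v) = 0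

/-- The triple `(Λ, φ, J)`, with `Λ = ι(L)`, is tame on `U`: at each point of `Λ ∩ U` the gradient
of `φ` for the triad metric exists as a vector tangent to `Λ`. -/
def IsTameTripleOn (ι : L → M) (φ : M → ℝ) (U : Set M) : Prop :=
  ∀ q, ι q ∈ U → ∃ u : TangentSpace (𝓡 n) q, ∀ v : TangentSpace (𝓡 (2 * n + 1)) (ι q),
    T.metric (ι q) (mfderiv (𝓡 n) (𝓡 (2 * n + 1)) ι q u) v
      = differential (𝓡 (2 * n + 1)) φ (ι q) v

end Contact

section Surface

variable {S : Type*} [TopologicalSpace S] [ChartedSpace (EuclideanHalfSpace 2) S]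

/-- `e` is a holomorphic (isothermal) coordinate for `j`: a smooth chart with values in the half
plane `{(x, y) | 0 ≤ x}` of `ℂ = ℝ²`, whose differential intertwines `j` and
`(x, y) ↦ (-y, x)`. -/
def IsHolomorphicChart (j : EndField (𝓡∂ 2) S)
    (e : OpenPartialHomeomorph S (EuclideanHalfSpace 2)) : Prop :=
  e ∈ IsManifold.maximalAtlas (𝓡∂ 2) ∞ S ∧
    ∀ z ∈ e.source, ∀ v : TangentSpace (𝓡∂ 2) z,
      let De : TangentSpace (𝓡∂ 2) z →L[ℝ] EuclideanSpace ℝ (Fin 2) :=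
        mfderiv (𝓡∂ 2) 𝓘(ℝ, EuclideanSpace ℝ (Fin 2)) (e.extend (𝓡∂ 2)) z
      De (j z v) = !₂[-(De v 1), De v 0]

/-- `(S, j)` is a Riemann surface with (possibly empty) boundary: `j` is smooth with `j² = -1`
and `S` is covered by holomorphic coordinates. -/
structure IsRiemannSurface [IsManifold (𝓡∂ 2) ∞ S] (j : EndField (𝓡∂ 2) S) : Prop where
  smooth : j.IsSmooth
  sq : ∀ z v, j z (j z v) = -v
  exists_chart : ∀ z, ∃ e, z ∈ e.source ∧ IsHolomorphicChart j e

/-- `f` is subharmonic on `V`: `Δ f ≥ 0` at the points of `V`, in every holomorphic coordinate.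
(For a metric compatible with `j` the Laplacian is a positive multiple of the coordinate
one.) -/
def IsSubharmonicOn (j : EndField (𝓡∂ 2) S) (f : S → ℝ) (V : Set S) : Prop :=
  ∀ e, IsHolomorphicChart j e → ∀ z ∈ e.source ∩ V,
    0 ≤ (Δ[range (𝓡∂ 2)] (f ∘ (e.extend (𝓡∂ 2)).symm)) (e.extend (𝓡∂ 2) z)

/-- `v` is tangent to the boundary at the boundary point `z`: the component of `v` transverse to
the boundary of the half plane vanishes in the chart at `z`. -/
def IsBoundaryTangent (z : S) (v : TangentSpace (𝓡∂ 2) z) : Prop :=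
  let c : TangentSpace (𝓡∂ 2) z →L[ℝ] EuclideanSpace ℝ (Fin 2) :=
    mfderiv (𝓡∂ 2) 𝓘(ℝ, EuclideanSpace ℝ (Fin 2)) (extChartAt (𝓡∂ 2) z) z
  c v 0 = 0

end Surface

section Instanton

variable {n : ℕ} {M : Type*} [TopologicalSpace M]
  [ChartedSpace (EuclideanSpace ℝ (Fin (2 * n + 1))) M] [IsManifold (𝓡 (2 * n + 1)) ∞ M]
  {S : Type*} [TopologicalSpace S] [ChartedSpace (EuclideanHalfSpace 2) S]
  {L : Type*}

/-- The one-form `w^* lam ∘ j` on the surface. -/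
def chargeForm (T : ContactTriad n M) (j : EndField (𝓡∂ 2) S) (w : S → M) :
    OneForm (𝓡∂ 2) S :=
  fun z => (T.lam (w z)).comp ((mfderiv (𝓡∂ 2) (𝓡 (2 * n + 1)) w z).comp (j z))

/-- `w : (S, ∂S) → (M, ι(L))` is a contact instanton: a smooth map with `∂̄^π w = 0`,
that is `π ∘ dw ∘ j = J ∘ π ∘ dw`, with `d(w^* lam ∘ j) = 0` and with boundary on `ι(L)`. -/
structure IsContactInstanton (T : ContactTriad n M) (j : EndField (𝓡∂ 2) S) (ι : L → M)
    (w : S → M) : Prop where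
  smooth : ContMDiff (𝓡∂ 2) (𝓡 (2 * n + 1)) ∞ w
  cauchyRiemann : ∀ z v,
    T.proj (w z) (mfderiv (𝓡∂ 2) (𝓡 (2 * n + 1)) w z (j z v)) =
      T.J (w z) (T.proj (w z) (mfderiv (𝓡∂ 2) (𝓡 (2 * n + 1)) w z v))
  closed : ∀ z u v, (chargeForm T j w).d _ z u v = 0
  boundary : ∀ z ∈ (𝓡∂ 2).boundary S, w z ∈ range ι

end Instanton

end ContactInstanton

end

/-! Put `f = φ ∘ w`. The instanton equation says that `dw ∘ j` is `J ∘ dw` plus a Reeb component,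
and that component is the charge form `w^*λ ∘ j`. Hence `df ∘ j = w^*(dφ ∘ J) + (dφ(R) ∘ w) • (w^*λ
∘ j)`. In a holomorphic coordinate `-d(df ∘ j) = Δf dx ∧ dy`. The last summand contributes nothing
to the exterior derivative: λ-tameness and `ddφ = 0` make `dφ(R)` stationary on `U`, and the charge
form is closed. So `Δf` is `-d(dφ ∘ J)` on the pair `dw(∂x)`, `dw(∂y)`, whose horizontal parts are
exchanged by `J`, and contact convexity gives the sign (`IsContactInstanton.laplacian_eq`,
`IsContactConvexOn.d_nonpos`).

On the boundary, `dw` of a tangent vector is tangent to the Legendrian. There `grad φ` is tangent to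
`Λ` and `dλ` vanishes on `TΛ`, so `dφ(R) = g(grad φ, R) = 0` and `dφ(JX) = g(grad φ, JX) = -dλ(grad
φ, X) = 0`. The formula for `df ∘ j` then gives the Neumann condition
(`IsContactInstanton.differential_comp_eq_zero`).

The maximum principle comes from a mean value argument instead of the Hopf lemma. On a half disc
centred at a boundary point the Neumann condition kills the flux through the diameter; on a full
disc cut along a ray the two sides cancel. In both cases the divergence theorem makes the mean of
`f` over arcs at least the value at the centre, so a maximum at the centre forces `f` to be constant
(`eq_apply_vertex_of_subharmonic`). Connectedness makes this global. -/

noncomputable section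

namespace ContactInstanton

/-! ### Mean value inequality and maximum principle on a plane sector. -/

section PolarCoordinates

open MeasureTheory

/-- The unit vector at angle `θ`. -/
def polarDir (θ : ℝ) : EuclideanSpace ℝ (Fin 2) := !₂[Real.cos θ, Real.sin θ]

/-- The derivative of `polarDir`. -/
def polarNormal (θ : ℝ) : EuclideanSpace ℝ (Fin 2) := !₂[-Real.sin θ, Real.cos θ]

theorem polarDir_eq (θ : ℝ) : polarDir θ = Real.cos θ • !₂[1, 0] + Real.sin θ • !₂[0, 1] := by
  ext i; fin_cases i <;> simp [polarDir]

theorem polarNormal_eq (θ : ℝ) :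
    polarNormal θ = -Real.sin θ • !₂[1, 0] + Real.cos θ • !₂[0, 1] := by
  ext i; fin_cases i <;> simp [polarNormal]

theorem hasDerivAt_polarDir (θ : ℝ) : HasDerivAt polarDir (polarNormal θ) θ := by
  rw [polarNormal_eq, funext polarDir_eq]
  exact ((Real.hasDerivAt_cos θ).smul_const _).add ((Real.hasDerivAt_sin θ).smul_const _)

theorem hasDerivAt_polarNormal (θ : ℝ) : HasDerivAt polarNormal (-polarDir θ) θ := by
  rw [polarDir_eq, funext polarNormal_eq, neg_add, ← neg_smul, ← neg_smul]
  exact ((Real.hasDerivAt_sin θ).neg.smul_const _).add ((Real.hasDerivAt_cos θ).smul_const _)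

theorem continuous_polarDir : Continuous polarDir :=
  continuous_iff_continuousAt.2 fun θ => (hasDerivAt_polarDir θ).continuousAt

theorem continuous_polarNormal : Continuous polarNormal :=
  continuous_iff_continuousAt.2 fun θ => (hasDerivAt_polarNormal θ).continuousAt

theorem norm_polarDir (θ : ℝ) : ‖polarDir θ‖ = 1 := by
  rw [EuclideanSpace.norm_eq]
  simp [polarDir, Fin.sum_univ_two]

/-- The point with polar coordinates `x = (r, θ)` around `c`. -/
def polarPoint (c : EuclideanSpace ℝ (Fin 2)) (x : ℝ × ℝ) : EuclideanSpace ℝ (Fin 2) :=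
  c + x.1 • polarDir x.2

theorem continuous_polarPoint (c : EuclideanSpace ℝ (Fin 2)) : Continuous (polarPoint c) :=
  continuous_const.add (continuous_fst.smul (continuous_polarDir.comp continuous_snd))

theorem hasFDerivAt_polarDir_snd (x : ℝ × ℝ) :
    HasFDerivAt (fun x : ℝ × ℝ => polarDir x.2)
      ((ContinuousLinearMap.snd ℝ ℝ ℝ).smulRight (polarNormal x.2)) x := by
  refine ((hasDerivAt_polarDir x.2).hasFDerivAt.comp x hasFDerivAt_snd).congr_fderiv ?_
  ext <;> simp

theorem hasFDerivAt_polarNormal_snd (x : ℝ × ℝ) :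
    HasFDerivAt (fun x : ℝ × ℝ => polarNormal x.2)
      ((ContinuousLinearMap.snd ℝ ℝ ℝ).smulRight (-polarDir x.2)) x := by
  refine ((hasDerivAt_polarNormal x.2).hasFDerivAt.comp x hasFDerivAt_snd).congr_fderiv ?_
  ext <;> simp

theorem hasFDerivAt_polarPoint (c : EuclideanSpace ℝ (Fin 2)) (x : ℝ × ℝ) :
    HasFDerivAt (polarPoint c) (x.1 • (ContinuousLinearMap.snd ℝ ℝ ℝ).smulRight (polarNormal x.2)
      + (ContinuousLinearMap.fst ℝ ℝ ℝ).smulRight (polarDir x.2)) x := by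
  have := (hasFDerivAt_fst (𝕜 := ℝ) (p := x)).smul (hasFDerivAt_polarDir_snd x)
  exact this.const_add c

/-- The trace of a bilinear form does not depend on the orthonormal basis; this puts the Laplacian
in the polar frame. -/
theorem apply_polarDir_add_apply_polarNormal
    (B : EuclideanSpace ℝ (Fin 2) →L[ℝ] EuclideanSpace ℝ (Fin 2) →L[ℝ] ℝ) (θ : ℝ) :
    B (polarDir θ) (polarDir θ) + B (polarNormal θ) (polarNormal θ)
      = B !₂[1, 0] !₂[1, 0] + B !₂[0, 1] !₂[0, 1] := by
  rw [polarDir_eq, polarNormal_eq]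
  simp only [map_add, map_smul, add_apply, smul_apply,
    smul_eq_mul]
  linear_combination (B !₂[1, 0] !₂[1, 0] + B !₂[0, 1] !₂[0, 1]) * Real.sin_sq_add_cos_sq θ

variable {f : EuclideanSpace ℝ (Fin 2) → ℝ}
  {G : EuclideanSpace ℝ (Fin 2) → EuclideanSpace ℝ (Fin 2) →L[ℝ] ℝ}
  {B : EuclideanSpace ℝ (Fin 2) → EuclideanSpace ℝ (Fin 2) →L[ℝ] EuclideanSpace ℝ (Fin 2) →L[ℝ] ℝ}
  {c : EuclideanSpace ℝ (Fin 2)} {K : Set (EuclideanSpace ℝ (Fin 2))} {ρ a b : ℝ}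

/-- The flux of the gradient of a subharmonic function through an arc of radius `r` is
non-negative, when the normal derivatives along the two sides of the sector cancel. -/
theorem integral_radial_nonneg (hρ : 0 ≤ ρ) (hab : a ≤ b)
    (hK : ∀ x ∈ Icc (0, a) (ρ, b), polarPoint c x ∈ K)
    (hGc : ContinuousOn G K) (hBc : ContinuousOn B K)
    (hG : ∀ x ∈ Ioo 0 ρ ×ˢ Ioo a b, HasFDerivAt G (B (polarPoint c x)) (polarPoint c x))
    (hB : ∀ y ∈ K, 0 ≤ B y !₂[1, 0] !₂[1, 0] + B y !₂[0, 1] !₂[0, 1])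
    (hside : ∀ r ∈ Icc 0 ρ, G (polarPoint c (r, a)) (polarNormal a)
      = G (polarPoint c (r, b)) (polarNormal b)) :
    0 ≤ ∫ θ in a..b, ρ * G (polarPoint c (ρ, θ)) (polarDir θ) := by
  have hGp : ContinuousOn (fun x => G (polarPoint c x)) (Icc (0, a) (ρ, b)) :=
    hGc.comp (continuous_polarPoint c).continuousOn hK
  have hBp : ContinuousOn (fun x => B (polarPoint c x)) (Icc (0, a) (ρ, b)) :=
    hBc.comp (continuous_polarPoint c).continuousOn hK
  have cd : Continuous fun x : ℝ × ℝ => polarDir x.2 := continuous_polarDir.comp continuous_snd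
  have cn : Continuous fun x : ℝ × ℝ => polarNormal x.2 :=
    continuous_polarNormal.comp continuous_snd
  let L : ℝ × ℝ → ℝ × ℝ →L[ℝ] EuclideanSpace ℝ (Fin 2) := fun x =>
    x.1 • (ContinuousLinearMap.snd ℝ ℝ ℝ).smulRight (polarNormal x.2)
      + (ContinuousLinearMap.fst ℝ ℝ ℝ).smulRight (polarDir x.2)
  have hd : ∀ x ∈ Ioo (0, a).1 (ρ, b).1 ×ˢ Ioo (0, a).2 (ρ, b).2,
      HasFDerivAt (fun x => G (polarPoint c x)) ((B (polarPoint c x)).comp (L x)) x :=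
    fun x hx => (hG x hx).comp x (hasFDerivAt_polarPoint c x)
  -- The field on the `(r, θ)` rectangle is `(r ∂_r f, r⁻¹ ∂_θ f)`, whose divergence is `r Δf`.
  -- Written through `G` it involves no division by `r`, so it is continuous up to the vertex `r =
  -- 0`.
  have key := integral_divergence_prod_Icc_of_hasFDerivAt_of_le
    (fun x => x.1 * G (polarPoint c x) (polarDir x.2))
    (fun x => G (polarPoint c x) (polarNormal x.2)) _ _ (0, a) (ρ, b) ⟨hρ, hab⟩
    (continuous_fst.continuousOn.mul (hGp.clm_apply cd.continuousOn))
    (hGp.clm_apply cn.continuousOn)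
    (fun x hx => hasFDerivAt_fst.mul ((hd x hx).clm_apply (hasFDerivAt_polarDir_snd x)))
    (fun x hx => (hd x hx).clm_apply (hasFDerivAt_polarNormal_snd x))
  have hdiv : ∀ x : ℝ × ℝ, x.1 * (B (polarPoint c x) !₂[1, 0] !₂[1, 0]
        + B (polarPoint c x) !₂[0, 1] !₂[0, 1]) =
      (x.1 • ((G (polarPoint c x)).comp
        ((ContinuousLinearMap.snd ℝ ℝ ℝ).smulRight (polarNormal x.2))
        + ((B (polarPoint c x)).comp (L x)).flip (polarDir x.2)) +
        G (polarPoint c x) (polarDir x.2) • ContinuousLinearMap.fst ℝ ℝ ℝ) (1, 0)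
      + ((G (polarPoint c x)).comp
        ((ContinuousLinearMap.snd ℝ ℝ ℝ).smulRight (-polarDir x.2))
        + ((B (polarPoint c x)).comp (L x)).flip (polarNormal x.2)) (0, 1) := by
    intro x
    rw [← apply_polarDir_add_apply_polarNormal _ x.2]
    simp [L]
    ring
  simp only [← hdiv] at key
  have hint := key (ContinuousOn.integrableOn_Icc (continuous_fst.continuousOn.mul
    (((hBp.clm_apply continuousOn_const).clm_apply continuousOn_const).add
      ((hBp.clm_apply continuousOn_const).clm_apply continuousOn_const))))
  have hpos : 0 ≤ ∫ x in Icc (0, a) (ρ, b), x.1 * (B (polarPoint c x) !₂[1, 0] !₂[1, 0]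
        + B (polarPoint c x) !₂[0, 1] !₂[0, 1]) :=
    setIntegral_nonneg measurableSet_Icc fun x hx =>
      mul_nonneg hx.1.1 (hB _ (hK x hx))
  have hsides : (∫ x in (0 : ℝ)..ρ, G (polarPoint c (x, b)) (polarNormal b))
      = ∫ x in (0 : ℝ)..ρ, G (polarPoint c (x, a)) (polarNormal a) := by
    refine intervalIntegral.integral_congr fun r hr => ?_
    rw [uIcc_of_le hρ] at hr
    exact (hside r hr).symm
  rw [hint] at hpos
  -- Of the four edges only the arc `r = ρ` survives: the edge `r = 0` carries the factor `r`, and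
  -- the two sides cancel by `hside`.
  simp only [hsides, zero_mul, intervalIntegral.integral_zero] at hpos
  simpa using hpos

/-- Strong maximum principle on a sector, at its vertex, for a subharmonic function whose normal
derivatives along the two sides cancel. -/
theorem eq_apply_vertex_of_subharmonic (hρ : 0 ≤ ρ) (hab : a < b)
    (hK : ∀ x ∈ Icc (0, a) (ρ, b), polarPoint c x ∈ K)
    (hfc : ContinuousOn f K) (hGc : ContinuousOn G K) (hBc : ContinuousOn B K)
    (hf : ∀ x ∈ Ioo 0 ρ ×ˢ Ioo a b, HasFDerivAt f (G (polarPoint c x)) (polarPoint c x))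
    (hG : ∀ x ∈ Ioo 0 ρ ×ˢ Ioo a b, HasFDerivAt G (B (polarPoint c x)) (polarPoint c x))
    (hB : ∀ y ∈ K, 0 ≤ B y !₂[1, 0] !₂[1, 0] + B y !₂[0, 1] !₂[0, 1])
    (hside : ∀ r ∈ Icc 0 ρ, G (polarPoint c (r, a)) (polarNormal a)
      = G (polarPoint c (r, b)) (polarNormal b))
    (hmax : ∀ y ∈ K, f y ≤ f c) {θ : ℝ} (hθ : θ ∈ Icc a b) :
    f (polarPoint c (ρ, θ)) = f c := by
  have hGp : ContinuousOn (fun x : ℝ × ℝ => G (polarPoint c x) (polarDir x.2))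
      (Icc (0, a) (ρ, b)) :=
    (hGc.comp (continuous_polarPoint c).continuousOn hK).clm_apply
      (continuous_polarDir.comp continuous_snd).continuousOn
  have hfp : ContinuousOn (fun x : ℝ × ℝ => f (polarPoint c x)) (Icc (0, a) (ρ, b)) :=
    hfc.comp (continuous_polarPoint c).continuousOn hK
  have hray : ∀ r ∈ Icc 0 ρ, ContinuousOn (fun θ : ℝ => f (polarPoint c (r, θ))) (Icc a b) :=
    fun r hr => hfp.comp (by fun_prop) fun θ hθ => ⟨⟨hr.1, hθ.1⟩, hr.2, hθ.2⟩
  have hftc : ∀ θ ∈ Ioo a b, ∫ r in (0 : ℝ)..ρ, G (polarPoint c (r, θ)) (polarDir θ)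
      = f (polarPoint c (ρ, θ)) - f c := by
    intro θ hθ
    have hm : MapsTo (fun r : ℝ => (r, θ)) (Icc 0 ρ) (Icc (0, a) (ρ, b)) :=
      fun r hr => ⟨⟨hr.1, hθ.1.le⟩, hr.2, hθ.2.le⟩
    have h0 : f (polarPoint c (0, θ)) = f c := by simp [polarPoint]
    rw [← h0]
    refine intervalIntegral.integral_eq_sub_of_hasDerivAt_of_le hρ
      (f := fun r => f (polarPoint c (r, θ)))
      (hfp.comp (by fun_prop) hm) (fun r hr => ?_)
      (ContinuousOn.intervalIntegrable_of_Icc hρ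
        (hGp.comp (f := fun r : ℝ => (r, θ)) (by fun_prop) hm))
    have h1 : HasDerivAt (fun r : ℝ => polarPoint c (r, θ)) (polarDir θ) r := by
      simpa [polarPoint] using ((hasDerivAt_id r).smul_const (polarDir θ)).const_add c
    exact (hf (r, θ) ⟨hr, hθ⟩).comp_hasDerivAt r h1
  have hswap : ∫ r in (0 : ℝ)..ρ, ∫ θ in a..b, G (polarPoint c (r, θ)) (polarDir θ)
      = ∫ θ in a..b, ∫ r in (0 : ℝ)..ρ, G (polarPoint c (r, θ)) (polarDir θ) := by
    refine intervalIntegral_intervalIntegral_swap ?_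
    refine (ContinuousOn.integrableOn_Icc hGp).mono_set ?_
    rw [uIoc_of_le hρ, uIoc_of_le hab.le, ← Icc_prod_Icc]
    exact prod_mono Ioc_subset_Icc_self Ioc_subset_Icc_self
  -- The flux bound holds on every smaller sector and carries a factor `r`, which can be divided out
  -- since `Ioc` excludes `r = 0`.
  have hnonneg : 0 ≤ ∫ r in (0 : ℝ)..ρ, ∫ θ in a..b, G (polarPoint c (r, θ)) (polarDir θ) := by
    rw [intervalIntegral.integral_of_le hρ]
    refine setIntegral_nonneg measurableSet_Ioc fun r hr => ?_
    have := integral_radial_nonneg (c := c) (K := K) (G := G) (B := B) hr.1.le hab.le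
      (fun x hx => hK x ⟨hx.1, hx.2.1.trans hr.2, hx.2.2⟩) hGc hBc
      (fun x hx => hG x ⟨⟨hx.1.1, hx.1.2.trans_le hr.2⟩, hx.2⟩) hB
      (fun s hs => hside s ⟨hs.1, hs.2.trans hr.2⟩)
    rw [intervalIntegral.integral_const_mul] at this
    exact nonneg_of_mul_nonneg_right this hr.1
  have hcongr : ∫ θ in a..b, ∫ r in (0 : ℝ)..ρ, G (polarPoint c (r, θ)) (polarDir θ)
      = ∫ θ in a..b, (f (polarPoint c (ρ, θ)) - f c) := by
    rw [intervalIntegral.integral_of_le hab.le, intervalIntegral.integral_of_le hab.le,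
      integral_Ioc_eq_integral_Ioo, integral_Ioc_eq_integral_Ioo]
    exact setIntegral_congr_fun measurableSet_Ioo hftc
  rw [hswap, hcongr] at hnonneg
  -- The continuous function `f (polarPoint c (ρ, ·)) - f c` is nonpositive with nonnegative
  -- integral, so it cannot be negative anywhere, endpoints included.
  by_contra hne
  have hlt : f (polarPoint c (ρ, θ)) < f c :=
    lt_of_le_of_ne (hmax _ (hK _ ⟨⟨hρ, hθ.1⟩, le_rfl, hθ.2⟩)) hne
  have := intervalIntegral.integral_lt_integral_of_continuousOn_of_le_of_exists_lt hab
    ((hray ρ ⟨hρ, le_rfl⟩).sub continuousOn_const) (continuousOn_const (c := (0 : ℝ)))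
    (fun θ' hθ' => sub_nonpos.2 (hmax _ (hK _ ⟨⟨hρ, hθ'.1.le⟩, le_rfl, hθ'.2⟩)))
    ⟨θ, hθ, sub_neg.2 hlt⟩
  rw [intervalIntegral.integral_zero] at this
  exact absurd hnonneg (not_le.2 this)

end PolarCoordinates

/-! ### Exterior derivative of one-forms: naturality, `d ∘ d = 0`, differentiability. -/

section ExteriorDerivative

variable {E : Type*} [NormedAddCommGroup E] [NormedSpace ℝ E]
  {E' : Type*} [NormedAddCommGroup E'] [NormedSpace ℝ E']

/-- The exterior derivative within `s` of a one-form on a vector space. -/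
def extDerivOn (s : Set E) (β : E → E →L[ℝ] ℝ) (y u v : E) : ℝ :=
  fderivWithin ℝ β s y u v - fderivWithin ℝ β s y v u

theorem extDerivOn_congr {s : Set E} {α β : E → E →L[ℝ] ℝ} {y : E} (h : α =ᶠ[𝓝[s] y] β)
    (hy : y ∈ s) (u v : E) : extDerivOn s α y u v = extDerivOn s β y u v := by
  rw [extDerivOn, extDerivOn, h.fderivWithin_eq_of_mem hy]

theorem hasFDerivWithinAt_pullback {s : Set E'} {t : Set E} {G : E' → E} {y : E'}
    {β : E → E →L[ℝ] ℝ} (hs : UniqueDiffOn ℝ s) (hy : y ∈ s)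
    (hG : ContDiffWithinAt ℝ 2 G s y) (ht : ∀ᶠ y' in 𝓝[s] y, G y' ∈ t)
    (hβ : DifferentiableWithinAt ℝ β t (G y)) :
    HasFDerivWithinAt (fun y' => (β (G y')).comp (fderivWithin ℝ G s y'))
      ((ContinuousLinearMap.compL ℝ E' E ℝ (β (G y))).comp
          (fderivWithin ℝ (fderivWithin ℝ G s) s y)
        + ((ContinuousLinearMap.compL ℝ E' E ℝ).flip (fderivWithin ℝ G s y)).comp
          ((fderivWithin ℝ β t (G y)).comp (fderivWithin ℝ G s y))) s y := by
  have h1 : HasFDerivWithinAt G (fderivWithin ℝ G s y) s y :=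
    (hG.differentiableWithinAt (by norm_num)).hasFDerivWithinAt
  have h2 : DifferentiableWithinAt ℝ (fderivWithin ℝ G s) s y :=
    (hG.fderivWithin_right (m := 1) hs (by norm_num) hy).differentiableWithinAt (by norm_num)
  have hmono : s ∩ G ⁻¹' t ∈ 𝓝[s] y := inter_mem self_mem_nhdsWithin ht
  have h3 : HasFDerivWithinAt (fun y' => β (G y'))
      ((fderivWithin ℝ β t (G y)).comp (fderivWithin ℝ G s y)) s y := by
    have := hβ.hasFDerivWithinAt.comp y (h1.mono (inter_subset_left (t := G ⁻¹' t)))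
      (fun x hx => hx.2)
    exact this.mono_of_mem_nhdsWithin hmono
  exact h3.clm_comp h2.hasFDerivWithinAt

/-- The derivative of the pull-back has a second-derivative term of `G`, which is symmetric and
drops out on antisymmetrising. Symmetry at a boundary point of `s` needs `y` to be a limit of
interior points. -/
theorem extDerivOn_pullback {s : Set E'} {t : Set E} {G : E' → E} {y : E'}
    {β : E → E →L[ℝ] ℝ} (hs : UniqueDiffOn ℝ s) (hy : y ∈ s) (hy' : y ∈ closure (interior s))
    (hG : ContDiffWithinAt ℝ 2 G s y) (ht : ∀ᶠ y' in 𝓝[s] y, G y' ∈ t)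
    (hβ : DifferentiableWithinAt ℝ β t (G y)) (u v : E') :
    extDerivOn s (fun y' => (β (G y')).comp (fderivWithin ℝ G s y')) y u v
      = extDerivOn t β (G y) (fderivWithin ℝ G s y u) (fderivWithin ℝ G s y v) := by
  have hsymm : IsSymmSndFDerivWithinAt ℝ G s y :=
    hG.isSymmSndFDerivWithinAt (by simp) hs hy' hy
  rw [extDerivOn, (hasFDerivWithinAt_pullback hs hy hG ht hβ).fderivWithin (hs y hy), extDerivOn]
  simp [hsymm.eq u v]

theorem extDerivOn_swap (s : Set E) (β : E → E →L[ℝ] ℝ) (y u v : E) :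
    extDerivOn s β y u v = -extDerivOn s β y v u := by
  rw [extDerivOn, extDerivOn, neg_sub]

theorem extDerivOn_add_left (s : Set E) (β : E → E →L[ℝ] ℝ) (y u u' v : E) :
    extDerivOn s β y (u + u') v = extDerivOn s β y u v + extDerivOn s β y u' v := by
  simp only [extDerivOn, map_add, add_apply]
  ring

theorem extDerivOn_smul_left (s : Set E) (β : E → E →L[ℝ] ℝ) (y : E) (a : ℝ) (u v : E) :
    extDerivOn s β y (a • u) v = a * extDerivOn s β y u v := by
  simp only [extDerivOn, map_smul, smul_apply, smul_eq_mul]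
  ring

variable {H : Type*} [TopologicalSpace H] {I : ModelWithCorners ℝ E H}
  {M : Type*} [TopologicalSpace M] [ChartedSpace H M]

theorem OneForm.d_eq_extDerivOn (α : OneForm I M) (p : M) (u v : TangentSpace I p) :
    α.d I p u v = extDerivOn (range I) (α.inChart I p) (extChartAt I p p)
      (mfderiv I 𝓘(ℝ, E) (extChartAt I p) p u) (mfderiv I 𝓘(ℝ, E) (extChartAt I p) p v) := rfl

theorem OneForm.d_swap (α : OneForm I M) (p : M) (u v : TangentSpace I p) :
    α.d I p u v = -α.d I p v u :=
  extDerivOn_swap ..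

theorem OneForm.d_add_left (α : OneForm I M) (p : M) (u u' v : TangentSpace I p) :
    α.d I p (u + u') v = α.d I p u v + α.d I p u' v := by
  rw [OneForm.d_eq_extDerivOn, map_add]
  exact extDerivOn_add_left ..

theorem OneForm.d_smul_left (α : OneForm I M) (p : M) (a : ℝ) (u v : TangentSpace I p) :
    α.d I p (a • u) v = a * α.d I p u v := by
  rw [OneForm.d_eq_extDerivOn, map_smul]
  exact extDerivOn_smul_left ..

theorem OneForm.d_add_right (α : OneForm I M) (p : M) (u v v' : TangentSpace I p) :
    α.d I p u (v + v') = α.d I p u v + α.d I p u v' := by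
  rw [α.d_swap, α.d_add_left, α.d_swap p u v, α.d_swap p u v', neg_add]

theorem OneForm.d_smul_right (α : OneForm I M) (p : M) (a : ℝ) (u v : TangentSpace I p) :
    α.d I p u (a • v) = a * α.d I p u v := by
  rw [α.d_swap, α.d_smul_left, α.d_swap p u v, mul_neg]

theorem OneForm.d_neg_right (α : OneForm I M) (p : M) (u v : TangentSpace I p) :
    α.d I p u (-v) = -α.d I p u v := by
  rw [← neg_one_smul ℝ v, α.d_smul_right, neg_one_mul]

theorem OneForm.d_zero_right (α : OneForm I M) (p : M) (u : TangentSpace I p) :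
    α.d I p u 0 = 0 := by
  rw [← zero_smul ℝ (0 : TangentSpace I p), α.d_smul_right, zero_mul]

/-- The pull-back of a one-form under a map from a subset of a vector space. -/
def OneForm.pullbackOn (α : OneForm I M) (F : E' → M) (s : Set E') (y : E') : E' →L[ℝ] ℝ :=
  (α (F y)).comp (mfderivWithin 𝓘(ℝ, E') I F s y)

/-- The one-form `α` is differentiable at `p`, in the chart at `p`. -/
def OneForm.DifferentiableAt (α : OneForm I M) (p : M) : Prop :=
  DifferentiableWithinAt ℝ (α.inChart I p) (range I) (extChartAt I p p)

/-- Factoring `F` through the chart at `F y` turns a pull-back from the manifold into one between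
vector spaces, to which `extDerivOn_pullback` applies. -/
theorem OneForm.pullbackOn_eventuallyEq [IsManifold I 1 M] {s : Set E'} {F : E' → M} {y : E'}
    (α : OneForm I M) (hs : UniqueDiffOn ℝ s)
    (hF : ContMDiffWithinAt 𝓘(ℝ, E') I 1 F s y) (hy : y ∈ s) :
    α.pullbackOn F s =ᶠ[𝓝[s] y] fun y' => (α.inChart I (F y) (extChartAt I (F y) (F y'))).comp
      (fderivWithin ℝ (extChartAt I (F y) ∘ F) s y') := by
  have h1 : ∀ᶠ y' in 𝓝[s] y, ContMDiffWithinAt 𝓘(ℝ, E') I 1 F s y' := by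
    have := (contMDiffWithinAt_iff_contMDiffWithinAt_nhdsWithin (by simp)).1 hF
    rwa [insert_eq_of_mem hy] at this
  have h2 : ∀ᶠ y' in 𝓝[s] y, F y' ∈ (chartAt H (F y)).source :=
    hF.continuousWithinAt (((chartAt H (F y)).open_source).mem_nhds (mem_chart_source H (F y)))
  filter_upwards [h1, h2, self_mem_nhdsWithin] with y' h1 h2 hy'
  have h2' : F y' ∈ (extChartAt I (F y)).source := by rwa [extChartAt_source]
  have h3 : mfderivWithin 𝓘(ℝ, E') 𝓘(ℝ, E) (extChartAt I (F y) ∘ F) s y'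
      = (mfderiv I 𝓘(ℝ, E) (extChartAt I (F y)) (F y')).comp
        (mfderivWithin 𝓘(ℝ, E') I F s y') :=
    mfderiv_comp_mfderivWithin _ (mdifferentiableAt_extChartAt h2)
      (h1.mdifferentiableWithinAt (by simp)) (hs y' hy').uniqueMDiffWithinAt
  have h4 := mfderivWithin_extChartAt_symm_comp_mfderiv_extChartAt' (I := I) h2'
  -- The base point occurs in the type of `α q`, so it is generalised before the substitution.
  have h5 : ∀ q, q = F y' → ∀ A : E →L[ℝ] E, ((α q : E →L[ℝ] ℝ)).comp A
      = (α (F y') : E →L[ℝ] ℝ).comp A := by rintro q rfl A; rfl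
  ext u
  rw [← mfderivWithin_eq_fderivWithin, h3]
  have h6 := h5 _ ((extChartAt I (F y)).left_inv h2')
    (mfderivWithin 𝓘(ℝ, E) I (extChartAt I (F y)).symm (range I) (extChartAt I (F y) (F y')))
  have h7 := DFunLike.congr_fun h4 (mfderivWithin 𝓘(ℝ, E') I F s y' u)
  have h8 := DFunLike.congr_fun h6 (mfderiv I 𝓘(ℝ, E) (extChartAt I (F y)) (F y')
    (mfderivWithin 𝓘(ℝ, E') I F s y' u))
  refine Eq.trans ?_ h8.symm
  exact (congrArg (α (F y')) h7).symm

theorem contDiffWithinAt_extChartAt_comp {s : Set E'} {F : E' → M} {y : E'} [IsManifold I 2 M]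
    (hF : ContMDiffWithinAt 𝓘(ℝ, E') I 2 F s y) :
    ContDiffWithinAt ℝ 2 (extChartAt I (F y) ∘ F) s y :=
  (contMDiffAt_extChartAt.comp_contMDiffWithinAt y hF).contDiffWithinAt

section

variable [IsManifold I 1 M] {s : Set E'} {F : E' → M} {y : E'} {α : OneForm I M}

theorem OneForm.differentiableWithinAt_pullbackOn [IsManifold I 2 M] (hs : UniqueDiffOn ℝ s)
    (hy : y ∈ s) (hF : ContMDiffWithinAt 𝓘(ℝ, E') I 2 F s y)
    (hα : α.DifferentiableAt (F y)) : DifferentiableWithinAt ℝ (α.pullbackOn F s) s y := by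
  have h := hasFDerivWithinAt_pullback hs hy (contDiffWithinAt_extChartAt_comp hF)
    (Eventually.of_forall fun y' => by simp) hα
  exact (h.congr_of_eventuallyEq (α.pullbackOn_eventuallyEq hs
    (hF.of_le (by norm_num)) hy) ((α.pullbackOn_eventuallyEq hs
    (hF.of_le (by norm_num)) hy).eq_of_nhdsWithin hy)).differentiableWithinAt

theorem OneForm.extDerivOn_pullbackOn [IsManifold I 2 M] (hs : UniqueDiffOn ℝ s) (hy : y ∈ s)
    (hy' : y ∈ closure (interior s)) (hF : ContMDiffWithinAt 𝓘(ℝ, E') I 2 F s y)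
    (hα : α.DifferentiableAt (F y)) (u v : E') :
    extDerivOn s (α.pullbackOn F s) y u v
      = α.d I (F y) (mfderivWithin 𝓘(ℝ, E') I F s y u) (mfderivWithin 𝓘(ℝ, E') I F s y v) := by
  rw [extDerivOn_congr (α.pullbackOn_eventuallyEq hs (hF.of_le (by norm_num)) hy) hy]
  have h := extDerivOn_pullback hs hy hy' (contDiffWithinAt_extChartAt_comp hF)
    (t := range I) (Eventually.of_forall fun y' => by simp) hα u v
  refine h.trans ?_
  have h3 : mfderivWithin 𝓘(ℝ, E') 𝓘(ℝ, E) (extChartAt I (F y) ∘ F) s y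
      = (mfderiv I 𝓘(ℝ, E) (extChartAt I (F y)) (F y)).comp
        (mfderivWithin 𝓘(ℝ, E') I F s y) :=
    mfderiv_comp_mfderivWithin _ (mdifferentiableAt_extChartAt (mem_chart_source H (F y)))
      (hF.mdifferentiableWithinAt (by simp)) (hs y hy).uniqueMDiffWithinAt
  rw [← mfderivWithin_eq_fderivWithin, h3]
  rfl

end

/-- Smoothness is stated in bundle trivialisations while `d` is computed in charts; this identifies
the two local expressions. -/
theorem OneForm.inCoordinates_eq_inChart [IsManifold I 1 M] (α : OneForm I M) (p : M) {y : E}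
    (hy : y ∈ (extChartAt I p).target) :
    ContinuousLinearMap.inCoordinates E (TangentSpace I : M → Type _) ℝ (Bundle.Trivial M ℝ) p
      ((extChartAt I p).symm y) p ((extChartAt I p).symm y) (α ((extChartAt I p).symm y))
      = α.inChart I p y := by
  have hs := (extChartAt I p).map_target hy
  rw [extChartAt_source] at hs
  rw [ContinuousLinearMap.inCoordinates, TangentBundle.symmL_trivializationAt hs,
    (extChartAt I p).right_inv hy]
  ext u
  simp [OneForm.inChart]

theorem OneForm.IsSmooth.differentiableAt [IsManifold I ∞ M] {α : OneForm I M} (hα : α.IsSmooth)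
    (p : M) : α.DifferentiableAt p := by
  have h := ((contMDiffAt_hom_bundle _).1 (hα p)).2.comp_contMDiffWithinAt_of_eq
    (contMDiffWithinAt_extChartAt_symm_range_self p) (extChartAt_to_inv p)
  refine (h.contDiffWithinAt.differentiableWithinAt (by simp)).congr_of_eventuallyEq ?_
    (α.inCoordinates_eq_inChart p (mem_extChartAt_target p)).symm
  filter_upwards [extChartAt_target_mem_nhdsWithin p] with y hy
  exact (α.inCoordinates_eq_inChart p hy).symm

/-- The field of endomorphisms `A` read in the chart at `p`. -/
def EndField.inChart (A : EndField I M) (p : M) (y : E) : E →L[ℝ] E :=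
  (mfderiv I 𝓘(ℝ, E) (extChartAt I p) ((extChartAt I p).symm y)).comp
    ((A ((extChartAt I p).symm y)).comp
      (mfderivWithin 𝓘(ℝ, E) I (extChartAt I p).symm (range I) y))

theorem EndField.inCoordinates_eq_inChart [IsManifold I 1 M] (A : EndField I M) (p : M) {y : E}
    (hy : y ∈ (extChartAt I p).target) :
    ContinuousLinearMap.inCoordinates E (TangentSpace I : M → Type _) E
      (TangentSpace I : M → Type _) p ((extChartAt I p).symm y) p ((extChartAt I p).symm y)
      (A ((extChartAt I p).symm y)) = A.inChart p y := by
  have hs := (extChartAt I p).map_target hy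
  rw [extChartAt_source] at hs
  rw [ContinuousLinearMap.inCoordinates, TangentBundle.symmL_trivializationAt hs,
    TangentBundle.continuousLinearMapAt_trivializationAt hs, (extChartAt I p).right_inv hy]
  rfl

theorem EndField.IsSmooth.differentiableWithinAt_inChart [IsManifold I ∞ M] {A : EndField I M}
    (hA : A.IsSmooth) (p : M) :
    DifferentiableWithinAt ℝ (A.inChart p) (range I) (extChartAt I p p) := by
  have h := ((contMDiffAt_hom_bundle _).1 (hA p)).2.comp_contMDiffWithinAt_of_eq
    (contMDiffWithinAt_extChartAt_symm_range_self p) (extChartAt_to_inv p)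
  refine (h.contDiffWithinAt.differentiableWithinAt (by simp)).congr_of_eventuallyEq ?_
    (A.inCoordinates_eq_inChart p (mem_extChartAt_target p)).symm
  filter_upwards [extChartAt_target_mem_nhdsWithin p] with y hy
  exact (A.inCoordinates_eq_inChart p hy).symm

theorem OneForm.inChart_compEnd [IsManifold I 1 M] (α : OneForm I M) (A : EndField I M) (p : M)
    {y : E} (hy : y ∈ (extChartAt I p).target) :
    (α.compEnd I A).inChart I p y = (α.inChart I p y).comp (A.inChart p y) := by
  ext u
  have h := DFunLike.congr_fun (mfderivWithin_extChartAt_symm_comp_mfderiv_extChartAt (I := I) hy)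
    (A ((extChartAt I p).symm y)
      (mfderivWithin 𝓘(ℝ, E) I (extChartAt I p).symm (range I) y u))
  exact (congrArg (α ((extChartAt I p).symm y)) h).symm

theorem OneForm.DifferentiableAt.compEnd [IsManifold I ∞ M] {α : OneForm I M} {A : EndField I M}
    {p : M} (hα : α.DifferentiableAt p) (hA : A.IsSmooth) :
    (α.compEnd I A).DifferentiableAt p := by
  have h := hα.hasFDerivWithinAt.clm_comp (hA.differentiableWithinAt_inChart p).hasFDerivWithinAt
  refine (h.congr_of_eventuallyEq ?_
    (α.inChart_compEnd A p (mem_extChartAt_target p))).differentiableWithinAt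
  filter_upwards [extChartAt_target_mem_nhdsWithin p] with y hy
  exact α.inChart_compEnd A p hy

theorem inChart_differential [IsManifold I 1 M] {f : M → ℝ}
    (hf : ContMDiff I 𝓘(ℝ, ℝ) 1 f) (p : M) {y : E} (hy : y ∈ (extChartAt I p).target) :
    (differential I f).inChart I p y
      = fderivWithin ℝ (f ∘ (extChartAt I p).symm) (range I) y := by
  rw [← mfderivWithin_eq_fderivWithin]
  exact (mfderiv_comp_mfderivWithin y (hf.mdifferentiableAt (by simp))
    (mdifferentiableWithinAt_extChartAt_symm hy)
    (I.uniqueMDiffOn _ (extChartAt_target_subset_range p hy))).symm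

section

variable {f : M → ℝ}

theorem contDiffWithinAt_comp_extChartAt_symm [IsManifold I ∞ M]
    (hf : ContMDiff I 𝓘(ℝ, ℝ) ∞ f) (p : M) :
    ContDiffWithinAt ℝ 2 (f ∘ (extChartAt I p).symm) (range I) (extChartAt I p p) :=
  ((hf _).comp_contMDiffWithinAt _
    (contMDiffWithinAt_extChartAt_symm_range_self p)).contDiffWithinAt.of_le ENat.LEInfty.out

theorem differentiableAt_differential [IsManifold I ∞ M] (hf : ContMDiff I 𝓘(ℝ, ℝ) ∞ f) (p : M) :
    (differential I f).DifferentiableAt p := by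
  have h := (contDiffWithinAt_comp_extChartAt_symm hf p).fderivWithin_right (m := 1)
    I.uniqueDiffOn (by norm_num) (by simp)
  refine (h.differentiableWithinAt (by norm_num)).congr_of_eventuallyEq ?_
    (inChart_differential (hf.of_le (by simp)) p (mem_extChartAt_target p))
  filter_upwards [extChartAt_target_mem_nhdsWithin p] with y hy
  exact inChart_differential (hf.of_le (by simp)) p hy

theorem d_differential [IsManifold I ∞ M] (hf : ContMDiff I 𝓘(ℝ, ℝ) ∞ f) (p : M)
    (u v : TangentSpace I p) : (differential I f).d I p u v = 0 := by
  have h : (differential I f).inChart I p =ᶠ[𝓝[range I] (extChartAt I p p)]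
      fderivWithin ℝ (f ∘ (extChartAt I p).symm) (range I) := by
    filter_upwards [extChartAt_target_mem_nhdsWithin p] with y hy
    exact inChart_differential (hf.of_le (by simp)) p hy
  have hsymm := (contDiffWithinAt_comp_extChartAt_symm hf p).isSymmSndFDerivWithinAt (by simp)
    I.uniqueDiffOn (I.range_subset_closure_interior (by simp)) (by simp)
  refine (extDerivOn_congr h (by simp) _ _).trans ?_
  rw [extDerivOn, sub_eq_zero]
  exact hsymm.eq _ _

end

end ExteriorDerivative

/-! ### Tangent vectors and derivatives in an arbitrary chart of the atlas. -/

section Charts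

variable {E : Type*} [NormedAddCommGroup E] [NormedSpace ℝ E]
  {H : Type*} [TopologicalSpace H] {I : ModelWithCorners ℝ E H}
  {M : Type*} [TopologicalSpace M] [ChartedSpace H M]
  {e : OpenPartialHomeomorph M H}

theorem contMDiffWithinAt_extend_symm {n : ℕ∞ω} (he : e ∈ IsManifold.maximalAtlas I n M) {y : E}
    (hy : y ∈ (e.extend I).target) :
    ContMDiffWithinAt 𝓘(ℝ, E) I n (e.extend I).symm (range I) y := by
  obtain ⟨x, hx, rfl⟩ : ∃ x ∈ e.target, I x = y := by
    rw [e.extend_target'] at hy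
    exact hy
  refine (contMDiffOn_extend_symm he _ (mem_image_of_mem _ hx)).mono_of_mem_nhdsWithin ?_
  rw [← e.extend_target']
  have := e.extend_target_mem_nhdsWithin (I := I) (y := e.symm x) (e.map_target hx)
  simpa [hx] using this

/-- The tangent vector at `z` represented by the vector `a` in the chart `e`. -/
def chartVec (I : ModelWithCorners ℝ E H) (e : OpenPartialHomeomorph M H) (z : M) (a : E) :
    TangentSpace I z :=
  mfderivWithin 𝓘(ℝ, E) I (e.extend I).symm (range I) (e.extend I z) a

/-- The coordinates in the chart `e` of a tangent vector at `z`. -/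
def chartCoord (I : ModelWithCorners ℝ E H) (e : OpenPartialHomeomorph M H) (z : M)
    (v : TangentSpace I z) : E :=
  mfderiv I 𝓘(ℝ, E) (e.extend I) z v

variable {z : M}

theorem mfderivWithin_comp_extend_symm {F : Type*} [NormedAddCommGroup F] [NormedSpace ℝ F]
    {G : Type*} [TopologicalSpace G] {J : ModelWithCorners ℝ F G}
    {N : Type*} [TopologicalSpace N] [ChartedSpace G N]
    (he : e ∈ IsManifold.maximalAtlas I 1 M) (hz : z ∈ e.source) {k : M → N}
    (hk : MDifferentiableAt I J k z) (a : E) :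
    (mfderivWithin 𝓘(ℝ, E) J (k ∘ (e.extend I).symm) (range I) (e.extend I z) a : F)
      = mfderiv I J k z (chartVec I e z a) := by
  have hy : e.extend I z ∈ (e.extend I).target :=
    (e.extend I).map_source (by rwa [e.extend_source])
  have h := mfderiv_comp_mfderivWithin_of_eq (I := 𝓘(ℝ, E)) (I' := I) (I'' := J)
    (f := (e.extend I).symm) (g := k) hk
    ((contMDiffWithinAt_extend_symm he hy).mdifferentiableWithinAt (by simp))
    (I.uniqueMDiffOn _ (e.extend_target_subset_range hy)) (e.extend_left_inv hz)
  rw [h]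
  rfl

theorem chartCoord_chartVec (he : e ∈ IsManifold.maximalAtlas I 1 M) (hz : z ∈ e.source)
    (a : E) : chartCoord I e z (chartVec I e z a) = a := by
  have hy : e.extend I z ∈ (e.extend I).target :=
    (e.extend I).map_source (by rwa [e.extend_source])
  rw [chartCoord, ← mfderivWithin_comp_extend_symm he hz
    ((e.contMDiffAt_extend he hz).mdifferentiableAt (by simp)) a, mfderivWithin_eq_fderivWithin]
  have h : e.extend I ∘ (e.extend I).symm =ᶠ[𝓝[range I] (e.extend I z)] id := by
    filter_upwards [e.extend_target_mem_nhdsWithin hz] with x hx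
    exact (e.extend I).right_inv hx
  rw [h.fderivWithin_eq ((e.extend I).right_inv hy),
    fderivWithin_id (I.uniqueDiffOn _ (e.extend_target_subset_range hy))]
  rfl

theorem chartVec_chartCoord (he : e ∈ IsManifold.maximalAtlas I 1 M) (hz : z ∈ e.source)
    (v : TangentSpace I z) : chartVec I e z (chartCoord I e z v) = v := by
  have hy : e.extend I z ∈ (e.extend I).target :=
    (e.extend I).map_source (by rwa [e.extend_source])
  have h1 := ((contMDiffWithinAt_extend_symm he hy).mdifferentiableWithinAt
    (by simp)).hasMFDerivWithinAt
  have h2 := ((e.contMDiffAt_extend he hz).mdifferentiableAt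
    (by simp)).hasMFDerivAt.hasMFDerivWithinAt (s := univ)
  have h3 := (h1.comp z h2 fun x _ => by simp).hasMFDerivAt univ_mem
  have h4 : (e.extend I).symm ∘ e.extend I =ᶠ[𝓝 z] id := by
    filter_upwards [e.open_source.mem_nhds hz] with x hx
    exact e.extend_left_inv hx
  have h5 := hasMFDerivAt_unique ((hasMFDerivAt_id z).congr_of_eventuallyEq h4) h3
  exact (DFunLike.congr_fun h5 v).symm

/-- A line that stays in the model range on both sides of the point gives a two-sided derivative
even at a boundary point. This is how boundary-tangent directions are handled. -/
theorem hasDerivAt_comp_extend_symm {F : Type*} [NormedAddCommGroup F] [NormedSpace ℝ F]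
    (he : e ∈ IsManifold.maximalAtlas I 1 M) (hz : z ∈ e.source) {k : M → F}
    (hk : MDifferentiableAt I 𝓘(ℝ, F) k z) {a : E}
    (ha : ∀ᶠ t : ℝ in 𝓝 0, e.extend I z + t • a ∈ range I) :
    HasDerivAt (fun t : ℝ => k ((e.extend I).symm (e.extend I z + t • a)))
      (mfderiv I 𝓘(ℝ, F) k z (chartVec I e z a)) 0 := by
  have hy : e.extend I z ∈ (e.extend I).target :=
    (e.extend I).map_source (by rwa [e.extend_source])
  have hk' : MDifferentiableAt I 𝓘(ℝ, F) k ((e.extend I).symm (e.extend I z)) := by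
    rwa [e.extend_left_inv hz]
  have h1 : DifferentiableWithinAt ℝ (k ∘ (e.extend I).symm) (range I) (e.extend I z) :=
    (hk'.comp_mdifferentiableWithinAt _
      ((contMDiffWithinAt_extend_symm he hy).mdifferentiableWithinAt
        (by simp))).differentiableWithinAt
  have h2 : HasDerivAt (fun t : ℝ => e.extend I z + t • a) a 0 := by
    simpa using ((hasDerivAt_id (0 : ℝ)).smul_const a).const_add (e.extend I z)
  have h3 : HasFDerivWithinAt (k ∘ (e.extend I).symm)
      (fderivWithin ℝ (k ∘ (e.extend I).symm) (range I) (e.extend I z)) (range I)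
      (e.extend I z + (0 : ℝ) • a) := by
    simpa using h1.hasFDerivWithinAt
  have h4 := (h3.comp_hasDerivWithinAt (0 : ℝ) (s := {t | e.extend I z + t • a ∈ range I})
    h2.hasDerivWithinAt fun t ht => ht).hasDerivAt ha
  refine h4.congr_deriv ?_
  rw [← mfderivWithin_comp_extend_symm he hz hk a, mfderivWithin_eq_fderivWithin]
  rfl

end Charts

/-! ### The boundary of the surface does not depend on the chart. -/

section HalfPlane

variable {S : Type*} [TopologicalSpace S] [ChartedSpace (EuclideanHalfSpace 2) S]
  {e e' : OpenPartialHomeomorph S (EuclideanHalfSpace 2)} {z : S}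

theorem mem_range_halfPlane {y : EuclideanSpace ℝ (Fin 2)} : y ∈ range (𝓡∂ 2) ↔ 0 ≤ y 0 := by
  rw [modelWithCornersEuclideanHalfSpace_toFun, range_euclideanHalfSpace]
  rfl

/-- In a chart that sends `z` to the boundary of the half plane, a vector which generates a line
inside the half plane in some other chart is tangent to the boundary. -/
theorem chartCoord_chartVec_zero_of_line (he : e ∈ IsManifold.maximalAtlas (𝓡∂ 2) 1 S)
    (he' : e' ∈ IsManifold.maximalAtlas (𝓡∂ 2) 1 S) (hz : z ∈ e.source) (hz' : z ∈ e'.source)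
    (h0 : e.extend (𝓡∂ 2) z 0 = 0) {a : EuclideanSpace ℝ (Fin 2)}
    (ha : ∀ᶠ t : ℝ in 𝓝 0, e'.extend (𝓡∂ 2) z + t • a ∈ range (𝓡∂ 2)) :
    chartCoord (𝓡∂ 2) e z (chartVec (𝓡∂ 2) e' z a) 0 = 0 := by
  have h := hasDerivAt_comp_extend_symm he' hz'
    ((e.contMDiffAt_extend he hz).mdifferentiableAt (by simp)) ha
  have h1 := (EuclideanSpace.proj (𝕜 := ℝ) (0 : Fin 2)).hasFDerivAt.comp_hasDerivAt (0 : ℝ) h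
  -- The transverse coordinate is nonnegative everywhere and vanishes at `z`, so it is minimal there
  -- along the line.
  have hmin : IsLocalMin (fun t : ℝ => (e.extend (𝓡∂ 2) ((e'.extend (𝓡∂ 2)).symm
      (e'.extend (𝓡∂ 2) z + t • a))) 0) 0 := by
    refine Eventually.of_forall fun t => ?_
    simp only [zero_smul, add_zero]
    rw [e'.extend_left_inv hz', h0]
    exact mem_range_halfPlane.1 (by simp)
  exact hmin.hasDerivAt_eq_zero h1

/-- If `z` were interior in `e'`, every direction would generate an admissible line, so the
differential of the transverse coordinate of `e` would vanish, against invertibility of the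
coordinate change. -/
theorem extend_zero_eq_zero (he : e ∈ IsManifold.maximalAtlas (𝓡∂ 2) 1 S)
    (he' : e' ∈ IsManifold.maximalAtlas (𝓡∂ 2) 1 S) (hz : z ∈ e.source) (hz' : z ∈ e'.source)
    (h0 : e.extend (𝓡∂ 2) z 0 = 0) : e'.extend (𝓡∂ 2) z 0 = 0 := by
  by_contra hne
  have hpos : 0 < e'.extend (𝓡∂ 2) z 0 :=
    lt_of_le_of_ne (mem_range_halfPlane.1 (by simp)) (Ne.symm hne)
  have ha : ∀ a : EuclideanSpace ℝ (Fin 2), ∀ᶠ t : ℝ in 𝓝 0,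
      e'.extend (𝓡∂ 2) z + t • a ∈ range (𝓡∂ 2) := by
    intro a
    have hc : ContinuousAt (fun t : ℝ => (e'.extend (𝓡∂ 2) z + t • a) 0) 0 := by fun_prop
    filter_upwards [hc.eventually_const_lt (u := 0) (by simpa using hpos)] with t ht
    exact mem_range_halfPlane.2 ht.le
  have h := chartCoord_chartVec_zero_of_line he he' hz hz' h0
    (ha (chartCoord (𝓡∂ 2) e' z (chartVec (𝓡∂ 2) e z !₂[1, 0])))
  rw [chartVec_chartCoord he' hz', chartCoord_chartVec he hz] at h
  simp at h

theorem mem_boundary_iff [IsManifold (𝓡∂ 2) 1 S]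
    (he : e ∈ IsManifold.maximalAtlas (𝓡∂ 2) 1 S) (hz : z ∈ e.source) :
    z ∈ (𝓡∂ 2).boundary S ↔ e.extend (𝓡∂ 2) z 0 = 0 := by
  have h : z ∈ (𝓡∂ 2).boundary S ↔ (chartAt (EuclideanHalfSpace 2) z).extend (𝓡∂ 2) z 0 = 0 := by
    change extChartAt (𝓡∂ 2) z z ∈ frontier (range (𝓡∂ 2)) ↔ _
    rw [frontier_range_modelWithCornersEuclideanHalfSpace]
    exact eq_comm
  rw [h]
  exact ⟨extend_zero_eq_zero (IsManifold.chart_mem_maximalAtlas z) he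
    (mem_chart_source _ z) hz,
    extend_zero_eq_zero he (IsManifold.chart_mem_maximalAtlas z) hz (mem_chart_source _ z)⟩

end HalfPlane

/-! ### Pull-backs under maps of manifolds, read in charts. -/

section PullbackInCharts

variable {E : Type*} [NormedAddCommGroup E] [NormedSpace ℝ E]
  {H : Type*} [TopologicalSpace H] {I : ModelWithCorners ℝ E H}
  {M : Type*} [TopologicalSpace M] [ChartedSpace H M]
  {F : Type*} [NormedAddCommGroup F] [NormedSpace ℝ F]
  {G : Type*} [TopologicalSpace G] {J : ModelWithCorners ℝ F G}
  {N : Type*} [TopologicalSpace N] [ChartedSpace G N]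
  {e : OpenPartialHomeomorph M H} {z : M} {k : M → N} {α : OneForm J N}

theorem OneForm.apply_congr (α : OneForm I M) {p p' : M} (h : p = p') (x : E) :
    (α p : E →L[ℝ] ℝ) x = (α p' : E →L[ℝ] ℝ) x := by
  subst h
  rfl

theorem OneForm.d_congr (α : OneForm I M) {p p' : M} (h : p = p') (x y : E) :
    α.d I p (x : TangentSpace I p) (y : TangentSpace I p)
      = α.d I p' (x : TangentSpace I p') (y : TangentSpace I p') := by
  subst h
  rfl

theorem OneForm.pullbackOn_comp_extend_symm (α : OneForm J N)
    (he : e ∈ IsManifold.maximalAtlas I 1 M) (hz : z ∈ e.source)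
    (hk : MDifferentiableAt I J k z) (a : E) :
    α.pullbackOn (k ∘ (e.extend I).symm) (range I) (e.extend I z) a
      = α (k z) (mfderiv I J k z (chartVec I e z a)) := by
  rw [← mfderivWithin_comp_extend_symm he hz hk a]
  exact α.apply_congr (congrArg k (e.extend_left_inv hz)) _

theorem contMDiffWithinAt_comp_extend_symm {n : ℕ∞ω} (he : e ∈ IsManifold.maximalAtlas I n M)
    (hz : z ∈ e.source) (hk : ContMDiffAt I J n k z) :
    ContMDiffWithinAt 𝓘(ℝ, E) J n (k ∘ (e.extend I).symm) (range I) (e.extend I z) :=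
  hk.comp_contMDiffWithinAt_of_eq (contMDiffWithinAt_extend_symm he
    ((e.extend I).map_source (by rwa [e.extend_source]))) (e.extend_left_inv hz)

theorem OneForm.DifferentiableAt.pullbackOn_comp_extend_symm [IsManifold J 1 N] [IsManifold J 2 N]
    (he : e ∈ IsManifold.maximalAtlas I 2 M) (hz : z ∈ e.source)
    (hk : ContMDiffAt I J 2 k z) (hα : α.DifferentiableAt (k z)) :
    DifferentiableWithinAt ℝ (α.pullbackOn (k ∘ (e.extend I).symm) (range I)) (range I)
      (e.extend I z) := by
  refine OneForm.differentiableWithinAt_pullbackOn I.uniqueDiffOn (by simp)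
    (contMDiffWithinAt_comp_extend_symm he hz hk) ?_
  rwa [Function.comp_apply, e.extend_left_inv hz]

theorem OneForm.extDerivOn_pullbackOn_comp_extend_symm [IsManifold J 1 N] [IsManifold J 2 N]
    (he : e ∈ IsManifold.maximalAtlas I 2 M) (he' : e ∈ IsManifold.maximalAtlas I 1 M)
    (hz : z ∈ e.source) (hk : ContMDiffAt I J 2 k z) (hα : α.DifferentiableAt (k z)) (a b : E) :
    extDerivOn (range I) (α.pullbackOn (k ∘ (e.extend I).symm) (range I)) (e.extend I z) a b
      = α.d J (k z) (mfderiv I J k z (chartVec I e z a)) (mfderiv I J k z (chartVec I e z b)) := by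
  rw [OneForm.extDerivOn_pullbackOn I.uniqueDiffOn (by simp)
    (I.range_subset_closure_interior (by simp)) (contMDiffWithinAt_comp_extend_symm he hz hk)
    (by rwa [Function.comp_apply, e.extend_left_inv hz])]
  rw [← mfderivWithin_comp_extend_symm he' hz (hk.mdifferentiableAt (by simp)) a,
    ← mfderivWithin_comp_extend_symm he' hz (hk.mdifferentiableAt (by simp)) b]
  exact α.d_congr (congrArg k (e.extend_left_inv hz)) _ _

/-- The pull-back of a one-form under a map of manifolds. -/
def OneForm.pullback (α : OneForm J N) (k : M → N) : OneForm I M :=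
  fun z => (α (k z)).comp (mfderiv I J k z)

theorem OneForm.DifferentiableAt.pullback [IsManifold I ∞ M] [IsManifold J ∞ N]
    (hk : ContMDiff I J ∞ k) (hα : α.DifferentiableAt (k z)) :
    (α.pullback k : OneForm I M).DifferentiableAt z := by
  have he := IsManifold.chart_mem_maximalAtlas (I := I) (n := 2) z
  have hz := mem_chart_source H z
  have h := hα.pullbackOn_comp_extend_symm he hz ((hk z).of_le ENat.LEInfty.out)
  have heq : ∀ y ∈ (extChartAt I z).target, (α.pullback k : OneForm I M).inChart I z y
      = α.pullbackOn (k ∘ (extChartAt I z).symm) (range I) y := by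
    intro y hy
    rw [OneForm.pullbackOn, mfderiv_comp_mfderivWithin y (hk.mdifferentiableAt (by simp))
      (mdifferentiableWithinAt_extChartAt_symm hy)
      (I.uniqueMDiffOn _ (extChartAt_target_subset_range z hy))]
    rfl
  refine h.congr_of_eventuallyEq ?_ (heq _ (mem_extChartAt_target z))
  filter_upwards [extChartAt_target_mem_nhdsWithin z] with y hy
  exact heq y hy

/-- The pull-back of a one-form whose restriction to the image of `k` vanishes is closed. -/
theorem OneForm.d_mfderiv_eq_zero [IsManifold I ∞ M] [IsManifold J ∞ N] (hk : ContMDiff I J ∞ k)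
    (hα : α.DifferentiableAt (k z)) (h0 : ∀ z v, α (k z) (mfderiv I J k z v) = 0)
    (u v : TangentSpace I z) : α.d J (k z) (mfderiv I J k z u) (mfderiv I J k z v) = 0 := by
  have he := IsManifold.chart_mem_maximalAtlas (I := I) (n := 2) z
  have he' := IsManifold.chart_mem_maximalAtlas (I := I) (n := 1) z
  have hz := mem_chart_source H z
  rw [← chartVec_chartCoord he' hz u, ← chartVec_chartCoord he' hz v,
    ← OneForm.extDerivOn_pullbackOn_comp_extend_symm he he' hz ((hk z).of_le ENat.LEInfty.out) hα]
  have hev : α.pullbackOn (k ∘ ((chartAt H z).extend I).symm) (range I)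
      =ᶠ[𝓝[range I] ((chartAt H z).extend I z)] fun _ => 0 := by
    filter_upwards [(chartAt H z).extend_target_mem_nhdsWithin (I := I) hz] with y hy
    have hs := ((chartAt H z).extend I).map_target hy
    rw [(chartAt H z).extend_source] at hs
    ext a
    rw [← ((chartAt H z).extend I).right_inv hy,
      α.pullbackOn_comp_extend_symm he' hs (hk.mdifferentiableAt (by simp)), h0]
    rfl
  rw [extDerivOn_congr hev (by simp), extDerivOn]
  simp

end PullbackInCharts

/-! ### Curves in an embedded submanifold have tangent velocity. -/

section Immersion

variable {E : Type*} [NormedAddCommGroup E] [NormedSpace ℝ E]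
  {H : Type*} [TopologicalSpace H] {I : ModelWithCorners ℝ E H}
  {S : Type*} [TopologicalSpace S] [ChartedSpace H S]
  {E₁ : Type*} [NormedAddCommGroup E₁] [NormedSpace ℝ E₁]
  {H₁ : Type*} [TopologicalSpace H₁] {I₁ : ModelWithCorners ℝ E₁ H₁}
  {L : Type*} [TopologicalSpace L] [ChartedSpace H₁ L]
  {F : Type*} [NormedAddCommGroup F] [NormedSpace ℝ F]
  {G : Type*} [TopologicalSpace G] {J : ModelWithCorners ℝ F G}
  {M : Type*} [TopologicalSpace M] [ChartedSpace G M]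
  {e : OpenPartialHomeomorph S H} {z : S} {w : S → M} {ι : L → M}

/-- The velocity of a curve inside an embedded submanifold is tangent to the submanifold. -/
theorem exists_mfderiv_eq_of_line [IsManifold I₁ ∞ L] [IsManifold J ∞ M]
    (hι : IsSmoothEmbedding I₁ J ∞ ι)
    (he : e ∈ IsManifold.maximalAtlas I 1 S) (hz : z ∈ e.source) (hw : MDifferentiableAt I J w z)
    {a : E} (ha : ∀ᶠ t : ℝ in 𝓝 0, e.extend I z + t • a ∈ range I)
    (hcurve : ∀ᶠ t : ℝ in 𝓝 0, w ((e.extend I).symm (e.extend I z + t • a)) ∈ range ι)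
    {q : L} (hq : ι q = w z) :
    ∃ v : TangentSpace I₁ q, (mfderiv I₁ J ι q v : F) = mfderiv I J w z (chartVec I e z a) := by
  have him := hι.isImmersion.isImmersionAt q
  set c := him.domChart
  set b := him.codChart
  have hc : c ∈ IsManifold.maximalAtlas I₁ 1 L :=
    IsManifold.maximalAtlas_subset_of_le (by simp) him.domChart_mem_maximalAtlas
  have hb : b ∈ IsManifold.maximalAtlas J 1 M :=
    IsManifold.maximalAtlas_subset_of_le (by simp) him.codChart_mem_maximalAtlas
  have hqc : q ∈ c.source := him.mem_domChart_source
  have hqb : ι q ∈ b.source := him.mem_codChart_source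
  have hchart : ∀ q' ∈ c.source, b.extend J (ι q') = him.equiv (c.extend I₁ q', 0) := by
    intro q' hq'
    have h := him.writtenInCharts ((c.extend I₁).map_source (by rwa [c.extend_source]))
    rwa [Function.comp_apply, Function.comp_apply, c.extend_left_inv hq'] at h
  -- In the immersion normal form `x ↦ (x, 0)`, a vector with zero component along the complement
  -- lies in the image of `dι`.
  have htangent : ∀ (p : M) (_ : ι q = p) (X : TangentSpace J p),
      (him.equiv.symm (chartCoord J b p X)).2 = 0 →
      ∃ v : TangentSpace I₁ q, (mfderiv I₁ J ι q v : F) = X := by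
    rintro p rfl X hX
    have hιd : MDifferentiableAt I₁ J ι q := hι.contMDiff.mdifferentiableAt (by simp)
    have hbd : MDifferentiableAt J 𝓘(ℝ, F) (b.extend J) (ι q) :=
      (b.contMDiffAt_extend hb hqb).mdifferentiableAt (by simp)
    set x := (him.equiv.symm (chartCoord J b (ι q) X)).1
    refine ⟨chartVec I₁ c q x, ?_⟩
    have h1 := mfderivWithin_comp_extend_symm hc hqc (hbd.comp q hιd) x
    have h2 : (b.extend J ∘ ι) ∘ (c.extend I₁).symm =ᶠ[𝓝[range I₁] (c.extend I₁ q)]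
        (him.equiv : E₁ × him.complement →L[ℝ] F).comp
          (ContinuousLinearMap.inl ℝ E₁ him.complement) := by
      filter_upwards [c.extend_target_mem_nhdsWithin (I := I₁) hqc] with y hy
      exact him.writtenInCharts hy
    have h3 : chartCoord J b (ι q) (mfderiv I₁ J ι q (chartVec I₁ c q x))
        = him.equiv (x, 0) := by
      rw [mfderiv_comp q hbd hιd, mfderivWithin_eq_fderivWithin,
        h2.fderivWithin_eq_of_mem (by simp), ContinuousLinearMap.fderivWithin _
          (I₁.uniqueDiffOn _ (by simp))] at h1
      exact h1.symm
    have h4 : chartCoord J b (ι q) X = him.equiv (x, 0) := by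
      rw [← him.equiv.symm_apply_eq]
      exact Prod.ext rfl hX
    rw [← chartVec_chartCoord hb hqb (mfderiv I₁ J ι q (chartVec I₁ c q x)), h3, ← h4,
      chartVec_chartCoord hb hqb]
  refine htangent (w z) hq _ ?_
  rw [hq] at hqb
  have hbd : MDifferentiableAt J 𝓘(ℝ, F) (b.extend J) (w z) :=
    (b.contMDiffAt_extend hb hqb).mdifferentiableAt (by simp)
  have hγ : ContinuousAt (fun t : ℝ => w ((e.extend I).symm (e.extend I z + t • a))) 0 := by
    have h1 : ContinuousAt (fun t : ℝ => e.extend I z + t • a) 0 := by fun_prop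
    refine ContinuousAt.comp_of_eq hw.continuousAt
      (ContinuousAt.comp_of_eq (e.continuousAt_extend_symm hz) h1 (by simp)) ?_
    simp only [zero_smul, add_zero]
    exact e.extend_left_inv hz
  have hγ0 : w ((e.extend I).symm (e.extend I z + (0 : ℝ) • a)) = ι q := by
    rw [zero_smul, add_zero, e.extend_left_inv hz, hq]
  -- A lift of the curve to `L`. It tends to `q` because `ι` is inducing; this keeps the curve in
  -- the slice chart and rules out returns along another sheet.
  let δ : ℝ → L := fun t =>
    @Function.invFun L M ⟨q⟩ ι (w ((e.extend I).symm (e.extend I z + t • a)))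
  have hδ : ∀ᶠ t : ℝ in 𝓝 0, ι (δ t) = w ((e.extend I).symm (e.extend I z + t • a)) := by
    filter_upwards [hcurve] with t ht
    exact @Function.invFun_eq L M ⟨q⟩ ι _ ht
  have hδ0 : Tendsto δ (𝓝 0) (𝓝 q) := by
    rw [hι.isEmbedding.isInducing.tendsto_nhds_iff, ← hγ0]
    exact hγ.tendsto.congr' (hδ.mono fun t ht => ht.symm)
  have hd := hasDerivAt_comp_extend_symm he hz (hbd.comp z hw) ha
  have hd' := ((ContinuousLinearMap.snd ℝ E₁ him.complement).comp
    (him.equiv.symm : F →L[ℝ] E₁ × him.complement)).hasFDerivAt.comp_hasDerivAt (0 : ℝ) hd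
  have hzero := hd'.congr_of_eventuallyEq (f₁ := fun _ : ℝ => (0 : him.complement)) (by
    filter_upwards [hδ, hδ0.eventually (c.open_source.mem_nhds hqc)] with t ht ht'
    have h := congrArg (fun y => (him.equiv.symm y).2) (hchart _ ht')
    simp only [ContinuousLinearEquiv.symm_apply_apply] at h
    rw [ht] at h
    exact h.symm)
  have hlast := hzero.unique (hasDerivAt_const (0 : ℝ) (0 : him.complement))
  rw [mfderiv_comp z hbd hw] at hlast
  exact hlast

end Immersion

/-! ### Pointwise consequences of tameness and convexity in the contact triad. -/

section Triad

variable {n : ℕ} {M : Type*} [TopologicalSpace M]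
  [ChartedSpace (EuclideanSpace ℝ (Fin (2 * n + 1))) M] [IsManifold (𝓡 (2 * n + 1)) ∞ M]
  {T : ContactTriad n M} {φ : M → ℝ} {U : Set M} {p : M}

theorem ContactTriad.lam_differentiableAt (T : ContactTriad n M) (p : M) :
    T.lam.DifferentiableAt p :=
  T.isContactForm.smooth.differentiableAt p

theorem ContactTriad.lam_proj (T : ContactTriad n M) (p : M)
    (v : TangentSpace (𝓡 (2 * n + 1)) p) : T.lam p (T.proj p v) = 0 := by
  rw [ContactTriad.proj, map_sub, map_smul, T.isReebField.apply_eq_one]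
  simp

theorem ContactTriad.J_proj (T : ContactTriad n M) (p : M)
    (v : TangentSpace (𝓡 (2 * n + 1)) p) : T.J p (T.proj p v) = T.J p v := by
  rw [ContactTriad.proj, map_sub, map_smul, T.isAdapted.apply_reeb, smul_zero, sub_zero]

theorem ContactTriad.proj_add_smul (T : ContactTriad n M) (p : M)
    (v : TangentSpace (𝓡 (2 * n + 1)) p) : T.proj p v + T.lam p v • T.R p = v := by
  rw [ContactTriad.proj, sub_add_cancel]

variable (T φ) in
/-- The derivative of `φ` along the Reeb field. -/
def reebDeriv (p : M) : ℝ := differential (𝓡 (2 * n + 1)) φ p (T.R p)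

/-- `dφ(R)` is the fibre component of `tangentMap φ` composed with the smooth section `R`. -/
theorem mdifferentiable_reebDeriv (hφ : ContMDiff (𝓡 (2 * n + 1)) 𝓘(ℝ, ℝ) ∞ φ) :
    MDifferentiable (𝓡 (2 * n + 1)) 𝓘(ℝ, ℝ) (reebDeriv T φ) := by
  have h1 : ContMDiff (𝓡 (2 * n + 1)).tangent 𝓘(ℝ, ℝ).tangent 1
      (tangentMap (𝓡 (2 * n + 1)) 𝓘(ℝ, ℝ) φ) :=
    hφ.contMDiff_tangentMap (by rw [one_add_one_eq_two]; exact ENat.LEInfty.out)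
  have h2 := h1.comp (T.isReebField.smooth.of_le (by simp))
  have h3 := (contMDiff_snd_tangentBundle_modelSpace ℝ 𝓘(ℝ, ℝ) (n := 1)).comp h2
  exact h3.mdifferentiable (by simp)

theorem differential_reebDeriv (hφ : ContMDiff (𝓡 (2 * n + 1)) 𝓘(ℝ, ℝ) ∞ φ)
    (htame : IsTameOn T φ U) (hp : p ∈ U) (v : TangentSpace (𝓡 (2 * n + 1)) p) :
    differential (𝓡 (2 * n + 1)) (reebDeriv T φ) p v = 0 := by
  have h := htame p hp v
  rw [lieDeriv, d_differential hφ, zero_add] at h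
  exact h

/-- On a contact `J`-convex set, `-d(dφ ∘ J)` is non-negative on pairs of vectors whose horizontal
parts are exchanged by `J`. -/
theorem IsContactConvexOn.d_nonpos (hconvex : IsContactConvexOn T φ U) (hp : p ∈ U)
    {X Y : TangentSpace (𝓡 (2 * n + 1)) p} (hY : T.proj p Y = T.J p (T.proj p X)) :
    ((differential (𝓡 (2 * n + 1)) φ).compEnd _ T.J).d _ p X Y ≤ 0 := by
  have hR := hconvex.reeb p hp
  have hR' : ∀ v, ((differential (𝓡 (2 * n + 1)) φ).compEnd _ T.J).d _ p v (T.R p) = 0 := by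
    intro v
    rw [OneForm.d_swap, hR, neg_zero]
  have h := hconvex.nonneg p hp _ (T.lam_proj p X)
  rw [← T.proj_add_smul p X, ← T.proj_add_smul p Y, OneForm.d_add_left, OneForm.d_smul_left, hR,
    OneForm.d_add_right, OneForm.d_smul_right, hR', hY]
  linarith

variable {L : Type*} [TopologicalSpace L] [ChartedSpace (EuclideanSpace ℝ (Fin n)) L]
  [IsManifold (𝓡 n) ∞ L] {ι : L → M}

/-- Along a Legendrian of a tame triple, `dφ(R)` and `dφ ∘ J` vanish on `TΛ`. -/
theorem IsTameTripleOn.differential_eq_zero (hι : IsLegendrian T ι)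
    (htriple : IsTameTripleOn T ι φ U) {q : L} (hq : ι q = p) (hp : p ∈ U)
    {X : TangentSpace (𝓡 (2 * n + 1)) p} {v : TangentSpace (𝓡 n) q}
    (hX : (mfderiv (𝓡 n) (𝓡 (2 * n + 1)) ι q v : EuclideanSpace ℝ (Fin (2 * n + 1))) = X) :
    reebDeriv T φ p = 0 ∧ differential (𝓡 (2 * n + 1)) φ p (T.J p X) = 0 := by
  subst hq
  subst hX
  obtain ⟨u, hu⟩ := htriple q hp
  have hlu := hι.tangent q u
  have hlv := hι.tangent q v
  have hd := OneForm.d_mfderiv_eq_zero hι.embedding.contMDiff (T.lam_differentiableAt (ι q))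
    hι.tangent u v
  constructor
  -- With `u` the gradient, `g(u, R) = λ(u)`, which is zero on a Legendrian.
  · rw [reebDeriv, ← hu, ContactTriad.metric, hlu, T.isAdapted.apply_reeb, OneForm.d_zero_right]
    simp
  -- `g(u, JX) = dλ(u, J²X) = -dλ(u, X)`, and `dλ` vanishes on the tangent spaces of a Legendrian.
  · rw [← hu, ContactTriad.metric, hlu, T.isAdapted.sq _ _ hlv, OneForm.d_neg_right, hd]
    simp

end Triad

/-! ### The Laplacian as `-d(df ∘ j)` in holomorphic coordinates. -/

section HolomorphicCharts

/-- The standard complex structure of the plane. -/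
def rotation : EuclideanSpace ℝ (Fin 2) →L[ℝ] EuclideanSpace ℝ (Fin 2) :=
  (-EuclideanSpace.proj (𝕜 := ℝ) (1 : Fin 2)).smulRight !₂[1, 0]
    + (EuclideanSpace.proj (𝕜 := ℝ) (0 : Fin 2)).smulRight !₂[0, 1]

theorem rotation_apply (a : EuclideanSpace ℝ (Fin 2)) : rotation a = !₂[-a 1, a 0] := by
  ext i
  fin_cases i <;> simp [rotation]

theorem rotation_fst : rotation !₂[1, 0] = !₂[0, 1] := by
  rw [rotation_apply]
  simp

theorem rotation_snd : rotation !₂[0, 1] = -!₂[1, 0] := by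
  rw [rotation_apply]
  ext i
  fin_cases i <;> simp

variable {S : Type*} [TopologicalSpace S] [ChartedSpace (EuclideanHalfSpace 2) S]
  {j : EndField (𝓡∂ 2) S} {e : OpenPartialHomeomorph S (EuclideanHalfSpace 2)} {z : S}

theorem IsHolomorphicChart.mem_maximalAtlas (he : IsHolomorphicChart j e) {m : ℕ∞ω} (hm : m ≤ ∞) :
    e ∈ IsManifold.maximalAtlas (𝓡∂ 2) m S :=
  IsManifold.maximalAtlas_subset_of_le hm he.1

theorem IsHolomorphicChart.apply_chartVec (he : IsHolomorphicChart j e) (hz : z ∈ e.source)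
    (a : EuclideanSpace ℝ (Fin 2)) :
    j z (chartVec (𝓡∂ 2) e z a) = chartVec (𝓡∂ 2) e z (rotation a) := by
  have he1 := he.mem_maximalAtlas (m := 1) (by simp)
  have h : chartCoord (𝓡∂ 2) e z (j z (chartVec (𝓡∂ 2) e z a))
      = rotation (chartCoord (𝓡∂ 2) e z (chartVec (𝓡∂ 2) e z a)) := by
    rw [rotation_apply]
    exact he.2 z hz _
  rw [← chartVec_chartCoord he1 hz (j z (chartVec (𝓡∂ 2) e z a)), h, chartCoord_chartVec he1 hz]

theorem laplacianWithin_eq {f : EuclideanSpace ℝ (Fin 2) → ℝ}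
    {s : Set (EuclideanSpace ℝ (Fin 2))} (hs : UniqueDiffOn ℝ s) {y : EuclideanSpace ℝ (Fin 2)}
    (hy : y ∈ s) : (Δ[s] f) y = fderivWithin ℝ (fderivWithin ℝ f s) s y !₂[1, 0] !₂[1, 0]
      + fderivWithin ℝ (fderivWithin ℝ f s) s y !₂[0, 1] !₂[0, 1] := by
  have h0 : EuclideanSpace.single (0 : Fin 2) (1 : ℝ) = !₂[1, 0] := by
    ext i; fin_cases i <;> simp
  have h1 : EuclideanSpace.single (1 : Fin 2) (1 : ℝ) = !₂[0, 1] := by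
    ext i; fin_cases i <;> simp
  rw [laplacianWithin_eq_iteratedFDerivWithin_orthonormalBasis f hs hy
    (EuclideanSpace.basisFun (Fin 2) ℝ), Fin.sum_univ_two]
  simp [iteratedFDerivWithin_two_apply f hs hy, h0, h1]

theorem extDerivOn_comp_rotation {f : EuclideanSpace ℝ (Fin 2) → ℝ}
    {s : Set (EuclideanSpace ℝ (Fin 2))} (hs : UniqueDiffOn ℝ s) {y : EuclideanSpace ℝ (Fin 2)}
    (hy : y ∈ s) (hf : ContDiffWithinAt ℝ 2 f s y) :
    extDerivOn s (fun x => (fderivWithin ℝ f s x).comp rotation) y !₂[1, 0] !₂[0, 1]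
      = -(Δ[s] f) y := by
  have h2 : DifferentiableWithinAt ℝ (fderivWithin ℝ f s) s y :=
    (hf.fderivWithin_right (m := 1) hs (by norm_num) hy).differentiableWithinAt (by norm_num)
  have h3 := (h2.hasFDerivWithinAt.clm_comp (hasFDerivWithinAt_const rotation y s)).fderivWithin
    (hs y hy)
  rw [laplacianWithin_eq hs hy, extDerivOn, h3]
  simp [rotation_fst, rotation_snd]
  ring

end HolomorphicCharts

/-! ### Subharmonicity of `φ ∘ w`. -/

section Subharmonic

variable {n : ℕ} {M : Type*} [TopologicalSpace M]
  [ChartedSpace (EuclideanSpace ℝ (Fin (2 * n + 1))) M] [IsManifold (𝓡 (2 * n + 1)) ∞ M]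
  {T : ContactTriad n M} {φ : M → ℝ} {U : Set M}
  {S : Type*} [TopologicalSpace S] [ChartedSpace (EuclideanHalfSpace 2) S]
  {j : EndField (𝓡∂ 2) S} {L : Type*} {ι : L → M} {w : S → M}
  {e : OpenPartialHomeomorph S (EuclideanHalfSpace 2)} {z : S}

/-- The horizontal part comes from the Cauchy–Riemann equation, where `J` ignores the Reeb
component; the Reeb part is the charge form by definition. -/
theorem IsContactInstanton.mfderiv_apply (hw : IsContactInstanton T j ι w) (z : S)
    (v : TangentSpace (𝓡∂ 2) z) :
    mfderiv (𝓡∂ 2) (𝓡 (2 * n + 1)) w z (j z v)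
      = T.J (w z) (mfderiv (𝓡∂ 2) (𝓡 (2 * n + 1)) w z v) + chargeForm T j w z v • T.R (w z) := by
  rw [← T.J_proj, ← hw.cauchyRiemann]
  exact (T.proj_add_smul _ _).symm

theorem IsContactInstanton.differential_comp_apply (hw : IsContactInstanton T j ι w)
    (hφ : ContMDiff (𝓡 (2 * n + 1)) 𝓘(ℝ, ℝ) ∞ φ) (z : S) (v : TangentSpace (𝓡∂ 2) z) :
    differential (𝓡∂ 2) (φ ∘ w) z (j z v)
      = (differential (𝓡 (2 * n + 1)) φ).compEnd _ T.J (w z)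
          (mfderiv (𝓡∂ 2) (𝓡 (2 * n + 1)) w z v)
        + reebDeriv T φ (w z) * chargeForm T j w z v := by
  have h : differential (𝓡∂ 2) (φ ∘ w) z = (differential (𝓡 (2 * n + 1)) φ (w z)).comp
      (mfderiv (𝓡∂ 2) (𝓡 (2 * n + 1)) w z) :=
    mfderiv_comp z (hφ.mdifferentiableAt (by simp)) (hw.smooth.mdifferentiableAt (by simp))
  rw [h, ContinuousLinearMap.comp_apply, hw.mfderiv_apply, map_add, map_smul, reebDeriv,
    smul_eq_mul, mul_comm (chargeForm T j w z v)]
  rfl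

theorem differentiableAt_chargeForm [IsManifold (𝓡∂ 2) ∞ S] (hj : j.IsSmooth)
    (hw : ContMDiff (𝓡∂ 2) (𝓡 (2 * n + 1)) ∞ w) (z : S) :
    (chargeForm T j w).DifferentiableAt z :=
  ((T.lam_differentiableAt (w z)).pullback hw).compEnd hj

theorem contDiffWithinAt_comp_chart {f : S → ℝ} (hf : ContMDiff (𝓡∂ 2) 𝓘(ℝ, ℝ) ∞ f)
    (he : IsHolomorphicChart j e) (hz : z ∈ e.source) :
    ContDiffWithinAt ℝ 2 (f ∘ (e.extend (𝓡∂ 2)).symm) (range (𝓡∂ 2)) (e.extend (𝓡∂ 2) z) :=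
  (contMDiffWithinAt_comp_extend_symm (he.mem_maximalAtlas ENat.LEInfty.out) hz
    ((hf z).of_le ENat.LEInfty.out)).contDiffWithinAt

theorem fderivWithin_comp_chart {f : S → ℝ} (hf : ContMDiff (𝓡∂ 2) 𝓘(ℝ, ℝ) ∞ f)
    (he : IsHolomorphicChart j e) (hz : z ∈ e.source) (a : EuclideanSpace ℝ (Fin 2)) :
    fderivWithin ℝ (f ∘ (e.extend (𝓡∂ 2)).symm) (range (𝓡∂ 2)) (e.extend (𝓡∂ 2) z) a
      = differential (𝓡∂ 2) f z (chartVec (𝓡∂ 2) e z a) := by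
  rw [← mfderivWithin_eq_fderivWithin]
  exact mfderivWithin_comp_extend_symm (he.mem_maximalAtlas (by simp)) hz
    (hf.mdifferentiableAt (by simp)) a

/-- `d(φ ∘ w) ∘ j = w^*(dφ ∘ J) + dφ(R) • w^*λ ∘ j`, in a holomorphic coordinate. -/
theorem IsContactInstanton.fderivWithin_comp_rotation [IsManifold (𝓡∂ 2) ∞ S]
    (hw : IsContactInstanton T j ι w)
    (hφ : ContMDiff (𝓡 (2 * n + 1)) 𝓘(ℝ, ℝ) ∞ φ) (he : IsHolomorphicChart j e)
    (hz : z ∈ e.source) :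
    (fderivWithin ℝ ((φ ∘ w) ∘ (e.extend (𝓡∂ 2)).symm) (range (𝓡∂ 2))
        (e.extend (𝓡∂ 2) z)).comp rotation
      = ((differential (𝓡 (2 * n + 1)) φ).compEnd _ T.J).pullbackOn
          (w ∘ (e.extend (𝓡∂ 2)).symm) (range (𝓡∂ 2)) (e.extend (𝓡∂ 2) z)
        + (reebDeriv T φ ∘ w ∘ (e.extend (𝓡∂ 2)).symm) (e.extend (𝓡∂ 2) z) •
          (chargeForm T j w).pullbackOn (id ∘ (e.extend (𝓡∂ 2)).symm) (range (𝓡∂ 2))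
            (e.extend (𝓡∂ 2) z) := by
  have he1 := he.mem_maximalAtlas (m := 1) (by simp)
  ext a
  rw [add_apply, smul_apply, OneForm.pullbackOn_comp_extend_symm _ he1 hz
    (hw.smooth.mdifferentiableAt (by simp)),
    OneForm.pullbackOn_comp_extend_symm _ he1 hz mdifferentiableAt_id, mfderiv_id,
    ContinuousLinearMap.comp_apply, fderivWithin_comp_chart (hφ.comp hw.smooth) he hz,
    ← he.apply_chartVec hz, hw.differential_comp_apply hφ, Function.comp_apply,
    Function.comp_apply, e.extend_left_inv hz]
  rfl

theorem IsContactInstanton.laplacian_eq [IsManifold (𝓡∂ 2) ∞ S] (hj : j.IsSmooth)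
    (hw : IsContactInstanton T j ι w)
    (hφ : ContMDiff (𝓡 (2 * n + 1)) 𝓘(ℝ, ℝ) ∞ φ) (htame : IsTameOn T φ U)
    (he : IsHolomorphicChart j e) (hz : z ∈ e.source) (hzU : w z ∈ U) :
    (Δ[range (𝓡∂ 2)] ((φ ∘ w) ∘ (e.extend (𝓡∂ 2)).symm)) (e.extend (𝓡∂ 2) z)
      = -((differential (𝓡 (2 * n + 1)) φ).compEnd _ T.J).d _ (w z)
        (mfderiv (𝓡∂ 2) (𝓡 (2 * n + 1)) w z (chartVec (𝓡∂ 2) e z !₂[1, 0]))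
        (mfderiv (𝓡∂ 2) (𝓡 (2 * n + 1)) w z (chartVec (𝓡∂ 2) e z !₂[0, 1])) := by
  have he1 := he.mem_maximalAtlas (m := 1) (by simp)
  have he2 := he.mem_maximalAtlas (m := 2) ENat.LEInfty.out
  have hy : e.extend (𝓡∂ 2) z ∈ range (𝓡∂ 2) := by simp
  have huniq := (𝓡∂ 2).uniqueDiffOn
  have hα := (differentiableAt_differential hφ (w z)).compEnd T.isAdapted.smooth
  have hκ := differentiableAt_chargeForm (T := T) hj hw.smooth z
  have hw2 := (hw.smooth z).of_le (ENat.LEInfty.out : (2 : ℕ∞ω) ≤ ∞)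
  have h1 := hα.pullbackOn_comp_extend_symm he2 hz hw2
  have h2 := hκ.pullbackOn_comp_extend_symm (k := id) he2 hz contMDiffAt_id
  have hd1 := OneForm.extDerivOn_pullbackOn_comp_extend_symm he2 he1 hz hw2 hα
    !₂[1, 0] !₂[0, 1]
  -- The charge form already lives on the surface, so it is pulled back by the inverse chart alone,
  -- that is with `k = id`.
  have hd2 := OneForm.extDerivOn_pullbackOn_comp_extend_symm (k := id) he2 he1 hz
    contMDiffAt_id hκ !₂[1, 0] !₂[0, 1]
  rw [id_eq, hw.closed] at hd2
  have hwz : MDifferentiableAt (𝓡∂ 2) (𝓡 (2 * n + 1)) w z :=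
    hw.smooth.mdifferentiableAt (by simp)
  have hreeb : MDifferentiableAt (𝓡∂ 2) 𝓘(ℝ, ℝ) (reebDeriv T φ ∘ w) z :=
    (mdifferentiable_reebDeriv hφ (w z)).comp z hwz
  -- Tameness kills the derivative of the coefficient `dφ(R)`, not its value; the term with the
  -- value is removed by `hd2`.
  have h3 : HasFDerivWithinAt (reebDeriv T φ ∘ w ∘ (e.extend (𝓡∂ 2)).symm)
      (0 : EuclideanSpace ℝ (Fin 2) →L[ℝ] ℝ) (range (𝓡∂ 2))
      (e.extend (𝓡∂ 2) z) := by
    have hdiff : DifferentiableWithinAt ℝ (reebDeriv T φ ∘ w ∘ (e.extend (𝓡∂ 2)).symm)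
        (range (𝓡∂ 2)) (e.extend (𝓡∂ 2) z) :=
      ((mdifferentiable_reebDeriv hφ _).comp_mdifferentiableWithinAt _
        ((contMDiffWithinAt_comp_extend_symm he2 hz hw2).mdifferentiableWithinAt
          (by simp))).differentiableWithinAt
    have hzero : fderivWithin ℝ (reebDeriv T φ ∘ w ∘ (e.extend (𝓡∂ 2)).symm) (range (𝓡∂ 2))
        (e.extend (𝓡∂ 2) z) = 0 := by
      ext a
      have := mfderivWithin_comp_extend_symm he1 hz hreeb a
      rw [mfderivWithin_eq_fderivWithin, mfderiv_comp z (mdifferentiable_reebDeriv hφ (w z))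
        hwz] at this
      exact this.trans (differential_reebDeriv hφ htame hzU _)
    rw [← hzero]
    exact hdiff.hasFDerivWithinAt
  have hev : (fun x => (fderivWithin ℝ ((φ ∘ w) ∘ (e.extend (𝓡∂ 2)).symm) (range (𝓡∂ 2))
      x).comp rotation) =ᶠ[𝓝[range (𝓡∂ 2)] (e.extend (𝓡∂ 2) z)]
      fun y => ((differential (𝓡 (2 * n + 1)) φ).compEnd _ T.J).pullbackOn
          (w ∘ (e.extend (𝓡∂ 2)).symm) (range (𝓡∂ 2)) y
        + (reebDeriv T φ ∘ w ∘ (e.extend (𝓡∂ 2)).symm) y •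
          (chargeForm T j w).pullbackOn (id ∘ (e.extend (𝓡∂ 2)).symm) (range (𝓡∂ 2)) y := by
    filter_upwards [e.extend_target_mem_nhdsWithin (I := 𝓡∂ 2) hz] with y hy
    have hs := (e.extend (𝓡∂ 2)).map_target hy
    rw [e.extend_source] at hs
    have := hw.fderivWithin_comp_rotation hφ he hs
    rwa [(e.extend (𝓡∂ 2)).right_inv hy] at this
  have hsum := (h1.hasFDerivWithinAt.fun_add (h3.fun_smul h2.hasFDerivWithinAt)).fderivWithin
    (huniq _ hy)
  have hlap := extDerivOn_comp_rotation huniq hy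
    (contDiffWithinAt_comp_chart (hφ.comp hw.smooth) he hz)
  rw [extDerivOn_congr hev hy] at hlap
  rw [← neg_eq_iff_eq_neg, ← hlap, ← hd1, extDerivOn, hsum]
  rw [extDerivOn] at hd2 ⊢
  simp only [add_apply, smul_apply, smul_eq_mul, ContinuousLinearMap.smulRight_apply, zero_apply,
    zero_smul, add_zero]
  linear_combination (reebDeriv T φ ∘ w ∘ (e.extend (𝓡∂ 2)).symm) (e.extend (𝓡∂ 2) z) * hd2

theorem IsContactInstanton.isSubharmonicOn [IsManifold (𝓡∂ 2) ∞ S] (hj : j.IsSmooth)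
    (hw : IsContactInstanton T j ι w)
    (hφ : ContMDiff (𝓡 (2 * n + 1)) 𝓘(ℝ, ℝ) ∞ φ) (htame : IsTameOn T φ U)
    (hconvex : IsContactConvexOn T φ U) : IsSubharmonicOn j (φ ∘ w) (w ⁻¹' U) := by
  rintro e he z ⟨hz, hzU⟩
  rw [hw.laplacian_eq hj hφ htame he hz hzU, Left.nonneg_neg_iff]
  refine hconvex.d_nonpos hzU ?_
  rw [← rotation_fst, ← he.apply_chartVec hz, hw.cauchyRiemann]

end Subharmonic

/-! ### The Neumann condition on the boundary. -/

section Boundary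

variable {n : ℕ} {M : Type*} [TopologicalSpace M]
  [ChartedSpace (EuclideanSpace ℝ (Fin (2 * n + 1))) M] [IsManifold (𝓡 (2 * n + 1)) ∞ M]
  {T : ContactTriad n M} {φ : M → ℝ} {U : Set M}
  {L : Type*} [TopologicalSpace L] [ChartedSpace (EuclideanSpace ℝ (Fin n)) L]
  [IsManifold (𝓡 n) ∞ L] {ι : L → M}
  {S : Type*} [TopologicalSpace S] [ChartedSpace (EuclideanHalfSpace 2) S]
  [IsManifold (𝓡∂ 2) ∞ S] {j : EndField (𝓡∂ 2) S} {w : S → M}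
  {e : OpenPartialHomeomorph S (EuclideanHalfSpace 2)} {z : S}

/-- The normal derivative of `φ ∘ w` vanishes at a boundary point; the tangent vectors to the
boundary are those represented in a chart by vectors with vanishing component transverse to the
boundary of the half plane. -/
theorem IsContactInstanton.differential_comp_eq_zero (hw : IsContactInstanton T j ι w)
    (hφ : ContMDiff (𝓡 (2 * n + 1)) 𝓘(ℝ, ℝ) ∞ φ) (hι : IsLegendrian T ι)
    (htriple : IsTameTripleOn T ι φ U) (he : e ∈ IsManifold.maximalAtlas (𝓡∂ 2) 1 S)
    (hz : z ∈ e.source) (hzb : z ∈ (𝓡∂ 2).boundary S) (hzU : w z ∈ U)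
    {a : EuclideanSpace ℝ (Fin 2)} (ha : a 0 = 0) :
    differential (𝓡∂ 2) (φ ∘ w) z (j z (chartVec (𝓡∂ 2) e z a)) = 0 := by
  have h0 := (mem_boundary_iff he hz).1 hzb
  obtain ⟨q, hq⟩ := hw.boundary z hzb
  -- The coordinate line in a tangent direction runs along the boundary, so `w` maps it into the
  -- Legendrian.
  have hline : ∀ t : ℝ, (e.extend (𝓡∂ 2) z + t • a) 0 = 0 := by
    intro t
    rw [PiLp.add_apply, h0, PiLp.smul_apply, ha]
    simp
  have hrange : ∀ t : ℝ, e.extend (𝓡∂ 2) z + t • a ∈ range (𝓡∂ 2) :=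
    fun t => mem_range_halfPlane.2 (hline t).ge
  have hcurve : ∀ᶠ t : ℝ in 𝓝 0,
      w ((e.extend (𝓡∂ 2)).symm (e.extend (𝓡∂ 2) z + t • a)) ∈ range ι := by
    have hc : Tendsto (fun t : ℝ => e.extend (𝓡∂ 2) z + t • a) (𝓝 0)
        (𝓝[range (𝓡∂ 2)] (e.extend (𝓡∂ 2) z)) := by
      refine tendsto_nhdsWithin_iff.2 ⟨?_, Eventually.of_forall hrange⟩
      have : ContinuousAt (fun t : ℝ => e.extend (𝓡∂ 2) z + t • a) 0 := by fun_prop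
      simpa [ContinuousAt] using this
    filter_upwards [hc (e.extend_target_mem_nhdsWithin (I := 𝓡∂ 2) hz)] with t ht
    have hs := (e.extend (𝓡∂ 2)).map_target ht
    rw [e.extend_source] at hs
    refine hw.boundary _ ((mem_boundary_iff he hs).2 ?_)
    rw [(e.extend (𝓡∂ 2)).right_inv ht, hline]
  obtain ⟨v, hv⟩ := exists_mfderiv_eq_of_line hι.embedding he hz
    (hw.smooth.mdifferentiableAt (by simp)) (Eventually.of_forall hrange) hcurve hq
  obtain ⟨h1, h2⟩ := htriple.differential_eq_zero hι hq hzU hv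
  rw [hw.differential_comp_apply hφ, h1, zero_mul, add_zero]
  exact h2

end Boundary

/-! ### Strong maximum principle on the surface, with Neumann boundary. -/

section MaximumPrinciple

theorem dist_polarPoint (c : EuclideanSpace ℝ (Fin 2)) {r : ℝ} (hr : 0 ≤ r) (θ : ℝ) :
    dist (polarPoint c (r, θ)) c = r := by
  rw [dist_eq_norm, polarPoint, add_sub_cancel_left, norm_smul, norm_polarDir, mul_one,
    Real.norm_of_nonneg hr]

theorem polarPoint_zero (c : EuclideanSpace ℝ (Fin 2)) (r θ : ℝ) :
    polarPoint c (r, θ) 0 = c 0 + r * Real.cos θ := by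
  simp [polarPoint, polarDir]

theorem exists_polarPoint_eq (c y : EuclideanSpace ℝ (Fin 2)) :
    ∃ θ ∈ Icc (-Real.pi) Real.pi, polarPoint c (dist y c, θ) = y ∧
      (c 0 ≤ y 0 → θ ∈ Icc (-(Real.pi / 2)) (Real.pi / 2)) := by
  let ζ : ℂ := ⟨y 0 - c 0, y 1 - c 1⟩
  have hζ : ‖ζ‖ = dist y c := by
    rw [EuclideanSpace.dist_eq, Complex.norm_eq_sqrt_sq_add_sq]
    simp [Fin.sum_univ_two, Real.dist_eq, sq_abs, ζ]
  refine ⟨ζ.arg, ⟨(Complex.neg_pi_lt_arg ζ).le, Complex.arg_le_pi ζ⟩, ?_, fun h => ?_⟩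
  · have h1 := Complex.norm_mul_cos_arg ζ
    have h2 := Complex.norm_mul_sin_arg ζ
    rw [hζ] at h1 h2
    ext i
    fin_cases i
    · simp [polarPoint, polarDir, h1, ζ]
    · simp [polarPoint, polarDir, h2, ζ]
  · exact abs_le.1 (Complex.abs_arg_le_pi_div_two_iff.2 (sub_nonneg.2 h))

theorem range_halfPlane_mem_nhds {y : EuclideanSpace ℝ (Fin 2)} (hy : 0 < y 0) :
    range (𝓡∂ 2) ∈ 𝓝 y := by
  have hc : ContinuousAt (fun x : EuclideanSpace ℝ (Fin 2) => x 0) y := by fun_prop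
  filter_upwards [hc.eventually_const_lt hy] with x hx
  exact mem_range_halfPlane.2 hx.le

variable {S : Type*} [TopologicalSpace S] [ChartedSpace (EuclideanHalfSpace 2) S]
  {j : EndField (𝓡∂ 2) S} {e : OpenPartialHomeomorph S (EuclideanHalfSpace 2)} {z : S}
  {f : S → ℝ} {V : Set S}

/-- Transfers the plane sector result to the surface. The derivatives of the chart expression are
taken within the half plane, so they are continuous up to its edge, and they are genuine derivatives
inside the sector, where `hint` keeps the points off the edge. -/
theorem eq_of_mem_sector (hf : ContMDiff (𝓡∂ 2) 𝓘(ℝ, ℝ) ∞ f) (he : IsHolomorphicChart j e)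
    (hz : z ∈ e.source) (hsub : IsSubharmonicOn j f V) {ε a b : ℝ} (hab : a < b)
    (hball : ∀ y ∈ Metric.ball (e.extend (𝓡∂ 2) z) ε ∩ range (𝓡∂ 2),
      y ∈ (e.extend (𝓡∂ 2)).target ∧ (e.extend (𝓡∂ 2)).symm y ∈ V ∧
        f ((e.extend (𝓡∂ 2)).symm y) ≤ f z)
    (hsector : ∀ r ∈ Ico 0 ε, ∀ θ ∈ Icc a b,
      0 ≤ polarPoint (e.extend (𝓡∂ 2) z) (r, θ) 0)
    (hint : ∀ r ∈ Ioo 0 ε, ∀ θ ∈ Ioo a b, 0 < polarPoint (e.extend (𝓡∂ 2) z) (r, θ) 0)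
    (hside : ∀ r ∈ Ico 0 ε,
      fderivWithin ℝ (f ∘ (e.extend (𝓡∂ 2)).symm) (range (𝓡∂ 2))
        (polarPoint (e.extend (𝓡∂ 2) z) (r, a)) (polarNormal a)
      = fderivWithin ℝ (f ∘ (e.extend (𝓡∂ 2)).symm) (range (𝓡∂ 2))
        (polarPoint (e.extend (𝓡∂ 2) z) (r, b)) (polarNormal b))
    {r θ : ℝ} (hr : r ∈ Ico 0 ε) (hθ : θ ∈ Icc a b) :
    f ((e.extend (𝓡∂ 2)).symm (polarPoint (e.extend (𝓡∂ 2) z) (r, θ))) = f z := by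
  set c := e.extend (𝓡∂ 2) z with hc
  set s := range (𝓡∂ 2)
  set g := f ∘ (e.extend (𝓡∂ 2)).symm with hg
  have huniq : UniqueDiffOn ℝ s := (𝓡∂ 2).uniqueDiffOn
  have hgc : g c = f z := congrArg f (e.extend_left_inv hz)
  have hdiff : ∀ y ∈ Metric.ball c ε ∩ s, ContDiffWithinAt ℝ 2 g s y := by
    intro y hy
    have ht := (hball y hy).1
    have hs := (e.extend (𝓡∂ 2)).map_target ht
    rw [e.extend_source] at hs
    have := contDiffWithinAt_comp_chart hf he hs
    rwa [(e.extend (𝓡∂ 2)).right_inv ht] at this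
  have hdiff1 : ∀ y ∈ Metric.ball c ε ∩ s, ContDiffWithinAt ℝ 1 (fderivWithin ℝ g s) s y :=
    fun y hy => (hdiff y hy).fderivWithin_right huniq (by norm_num) hy.2
  have hdiff2 : ∀ y ∈ Metric.ball c ε ∩ s,
      ContDiffWithinAt ℝ 0 (fderivWithin ℝ (fderivWithin ℝ g s) s) s y :=
    fun y hy => (hdiff1 y hy).fderivWithin_right huniq (by norm_num) hy.2
  have hmem : ∀ x ∈ Icc (0, a) (r, b), polarPoint c x ∈ Metric.ball c ε ∩ s := by
    intro x hx
    have hx1 : x.1 < ε := hx.2.1.trans_lt hr.2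
    refine ⟨?_, mem_range_halfPlane.2 (hsector x.1 ⟨hx.1.1, hx1⟩ x.2 ⟨hx.1.2, hx.2.2⟩)⟩
    rw [Metric.mem_ball]
    exact (dist_polarPoint c hx.1.1 x.2).trans_lt hx1
  have hnhds : ∀ x ∈ Ioo 0 r ×ˢ Ioo a b, s ∈ 𝓝 (polarPoint c x) := fun x hx =>
    range_halfPlane_mem_nhds (hint x.1 ⟨hx.1.1, hx.1.2.trans hr.2⟩ x.2 hx.2)
  have hIoo : ∀ x ∈ Ioo 0 r ×ˢ Ioo a b, x ∈ Icc (0, a) (r, b) := fun x hx =>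
    ⟨⟨hx.1.1.le, hx.2.1.le⟩, hx.1.2.le, hx.2.2.le⟩
  rw [← hgc]
  refine eq_apply_vertex_of_subharmonic (f := g) (G := fderivWithin ℝ g s)
    (B := fderivWithin ℝ (fderivWithin ℝ g s) s) hr.1 hab hmem
    (fun y hy => ((hdiff y hy).continuousWithinAt.mono inter_subset_right))
    (fun y hy => ((hdiff1 y hy).continuousWithinAt.mono inter_subset_right))
    (fun y hy => ((hdiff2 y hy).continuousWithinAt.mono inter_subset_right))
    (fun x hx => ((hdiff _ (hmem x (hIoo x hx))).differentiableWithinAt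
      (by norm_num)).hasFDerivWithinAt.hasFDerivAt (hnhds x hx))
    (fun x hx => ((hdiff1 _ (hmem x (hIoo x hx))).differentiableWithinAt
      (by norm_num)).hasFDerivWithinAt.hasFDerivAt (hnhds x hx))
    (fun y hy => ?_) (fun t ht => hside t ⟨ht.1, ht.2.trans_lt hr.2⟩)
    (fun y hy => (hball y hy).2.2.trans_eq hgc.symm) hθ
  have ht := (hball y hy).1
  have hs := (e.extend (𝓡∂ 2)).map_target ht
  rw [e.extend_source] at hs
  have h := hsub e he _ ⟨hs, (hball y hy).2.1⟩
  rwa [(e.extend (𝓡∂ 2)).right_inv ht, laplacianWithin_eq huniq hy.2] at h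

/-- Strong maximum principle for a subharmonic function on a Riemann surface whose normal
derivative vanishes along the boundary. -/
theorem eventually_eq_of_isLocalMax [IsManifold (𝓡∂ 2) 1 S]
    (hf : ContMDiff (𝓡∂ 2) 𝓘(ℝ, ℝ) ∞ f) (he : IsHolomorphicChart j e)
    (hz : z ∈ e.source) (hV : V ∈ 𝓝 z) (hsub : IsSubharmonicOn j f V)
    (hneumann : ∀ q ∈ V, q ∈ (𝓡∂ 2).boundary S → q ∈ e.source →
      ∀ a : EuclideanSpace ℝ (Fin 2), a 0 = 0 →
        differential (𝓡∂ 2) f q (j q (chartVec (𝓡∂ 2) e q a)) = 0)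
    (hmax : IsLocalMax f z) : ∀ᶠ z' in 𝓝 z, f z' = f z := by
  have he1 := he.mem_maximalAtlas (m := 1) (by simp)
  set c := e.extend (𝓡∂ 2) z with hc
  have hsymm : Tendsto (e.extend (𝓡∂ 2)).symm (𝓝[range (𝓡∂ 2)] c) (𝓝 z) := by
    have h := (e.continuousAt_extend_symm (I := 𝓡∂ 2) hz).tendsto
    rw [e.extend_left_inv hz] at h
    exact h.mono_left nhdsWithin_le_nhds
  have hev : ∀ᶠ y in 𝓝[range (𝓡∂ 2)] c, y ∈ (e.extend (𝓡∂ 2)).target ∧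
      (e.extend (𝓡∂ 2)).symm y ∈ V ∧ f ((e.extend (𝓡∂ 2)).symm y) ≤ f z :=
    Eventually.and (e.extend_target_mem_nhdsWithin (I := 𝓡∂ 2) hz) ((hsymm.eventually hV).and (hsymm.eventually hmax))
  obtain ⟨ε, hε, hball⟩ := Metric.mem_nhdsWithin_iff.1 hev
  have hc0 : 0 ≤ c 0 := mem_range_halfPlane.1 (by simp [hc])
  suffices h : ∃ δ > 0, ∀ y ∈ Metric.ball c δ ∩ range (𝓡∂ 2),
      f ((e.extend (𝓡∂ 2)).symm y) = f z by
    obtain ⟨δ, hδ, h⟩ := h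
    have hcont := (e.continuousAt_extend (I := 𝓡∂ 2) hz).eventually (Metric.ball_mem_nhds c hδ)
    filter_upwards [hcont, e.open_source.mem_nhds hz] with z' hz' hzs
    rw [← h _ ⟨hz', by simp⟩, e.extend_left_inv hzs]
  rcases hc0.eq_or_lt with h0 | h0
  · refine ⟨ε, hε, fun y hy => ?_⟩
    obtain ⟨θ, -, hpolar, hθ⟩ := exists_polarPoint_eq c y
    have hcos : ∀ θ ∈ Icc (-(Real.pi / 2)) (Real.pi / 2), 0 ≤ Real.cos θ :=
      fun θ hθ => Real.cos_nonneg_of_mem_Icc hθ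
    have hnormal : ∀ y ∈ Metric.ball c ε ∩ range (𝓡∂ 2), y 0 = 0 → ∀ t : ℝ,
        fderivWithin ℝ (f ∘ (e.extend (𝓡∂ 2)).symm) (range (𝓡∂ 2)) y !₂[t, 0] = 0 := by
      intro y hy hy0 t
      obtain ⟨ht, hyV, -⟩ := hball hy
      have hs := (e.extend (𝓡∂ 2)).map_target ht
      rw [e.extend_source] at hs
      have h1 := fderivWithin_comp_chart hf he hs !₂[t, 0]
      -- A normal vector is `j` of a boundary tangent, which is the form in which `hneumann`
      -- applies.
      have h2 : !₂[t, 0] = rotation !₂[0, -t] := by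
        rw [rotation_apply]
        simp
      rw [(e.extend (𝓡∂ 2)).right_inv ht] at h1
      rw [h1, h2, ← he.apply_chartVec hs]
      refine hneumann _ hyV ((mem_boundary_iff he1 hs).2 ?_) hs _ (by simp)
      rwa [(e.extend (𝓡∂ 2)).right_inv ht]
    have hside : ∀ r ∈ Ico 0 ε, ∀ θ : ℝ, Real.cos θ = 0 →
        fderivWithin ℝ (f ∘ (e.extend (𝓡∂ 2)).symm) (range (𝓡∂ 2))
          (polarPoint c (r, θ)) (polarNormal θ) = 0 := by
      intro r hr θ hθ
      have hp0 : polarPoint c (r, θ) 0 = 0 := by rw [polarPoint_zero, ← h0, hθ]; simp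
      rw [polarNormal, hθ]
      refine hnormal _ ⟨?_, mem_range_halfPlane.2 hp0.ge⟩ hp0 _
      rw [Metric.mem_ball, dist_polarPoint c hr.1]
      exact hr.2
    -- The half disc is the sector `[-π/2, π/2]`; on both of its sides `polarNormal` is normal to
    -- the boundary, so both side terms vanish.
    rw [← hpolar]
    refine eq_of_mem_sector hf he hz hsub (a := -(Real.pi / 2)) (b := Real.pi / 2)
      (by linarith [Real.pi_pos]) hball (fun r hr θ hθ => ?_) (fun r hr θ hθ => ?_)
      (fun r hr => ?_) ⟨dist_nonneg, hy.1⟩ (hθ ?_)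
    · rw [polarPoint_zero]
      exact add_nonneg hc0 (mul_nonneg hr.1 (hcos θ hθ))
    · rw [polarPoint_zero]
      exact add_pos_of_nonneg_of_pos hc0 (mul_pos hr.1 (Real.cos_pos_of_mem_Ioo hθ))
    · rw [hside r hr _ (by simp), hside r hr _ (by simp)]
    · rw [← h0]
      exact mem_range_halfPlane.1 hy.2
  -- At an interior point, radius at most `c 0` keeps the open disc off the edge of the half plane.
  · refine ⟨min ε (c 0), lt_min hε h0, fun y hy => ?_⟩
    obtain ⟨θ, hθ, hpolar, -⟩ := exists_polarPoint_eq c y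
    have hpos : ∀ r ∈ Ico 0 (min ε (c 0)), ∀ θ : ℝ, 0 < polarPoint c (r, θ) 0 := by
      intro r hr θ
      rw [polarPoint_zero]
      have h1 := Real.neg_one_le_cos θ
      have h2 : r < c 0 := hr.2.trans_le (min_le_right _ _)
      nlinarith [hr.1]
    rw [← hpolar]
    refine eq_of_mem_sector hf he hz hsub (a := -Real.pi) (b := Real.pi)
      (by linarith [Real.pi_pos])
      (fun y hy => hball ⟨Metric.ball_subset_ball (min_le_left _ _) hy.1, hy.2⟩)
      (fun r hr θ _ => (hpos r hr θ).le) (fun r hr θ _ => hpos r ⟨hr.1.le, hr.2⟩ θ)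
      (fun r _ => ?_) ⟨dist_nonneg, hy.1⟩ hθ
    -- The sides `θ = -π` and `θ = π` are the same ray with the same normal, so their terms agree.
    simp [polarPoint, polarDir, polarNormal]

end MaximumPrinciple

end ContactInstanton

end

/-! ### Assembly of the three statements. -/

theorem mainTheorem11 {n : ℕ}
    {M : Type*} [TopologicalSpace M] [ChartedSpace (EuclideanSpace ℝ (Fin (2 * n + 1))) M]
    [IsManifold (𝓡 (2 * n + 1)) ∞ M]
    (T : ContactInstanton.ContactTriad n M)
    {L : Type*} [TopologicalSpace L] [ChartedSpace (EuclideanSpace ℝ (Fin n)) L]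
    [IsManifold (𝓡 n) ∞ L]
    (ι : L → M) (hι : ContactInstanton.IsLegendrian T ι)
    (φ : M → ℝ) (hφ : ContMDiff (𝓡 (2 * n + 1)) 𝓘(ℝ, ℝ) ∞ φ)
    (U : Set M) (hU : IsOpen U)
    (htame : ContactInstanton.IsTameOn T φ U)
    (hconvex : ContactInstanton.IsContactConvexOn T φ U)
    (htriple : ContactInstanton.IsTameTripleOn T ι φ U)
    {S : Type*} [TopologicalSpace S] [ChartedSpace (EuclideanHalfSpace 2) S]
    [IsManifold (𝓡∂ 2) ∞ S]
    (j : ContactInstanton.EndField (𝓡∂ 2) S) (hj : ContactInstanton.IsRiemannSurface j)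
    (w : S → M) (hw : ContactInstanton.IsContactInstanton T j ι w) :
    ContactInstanton.IsSubharmonicOn j (φ ∘ w) (w ⁻¹' U) ∧
    (∀ z ∈ (𝓡∂ 2).boundary S, w z ∈ U → ∀ v : TangentSpace (𝓡∂ 2) z,
      ContactInstanton.IsBoundaryTangent z v →
        ContactInstanton.differential (𝓡∂ 2) (φ ∘ w) z (j z v) = 0) ∧
    (∀ z ∈ (𝓡∂ 2).boundary S, w z ∈ U → IsLocalMax (φ ∘ w) z →
      ∀ᶠ z' in 𝓝 z, φ (w z') = φ (w z)) ∧
    (∀ Ω : Set S, IsOpen Ω → IsPreconnected Ω → Ω ⊆ w ⁻¹' U →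
      ∀ z ∈ Ω ∩ (𝓡∂ 2).boundary S, (∀ z' ∈ Ω, φ (w z') ≤ φ (w z)) →
        ∀ z' ∈ Ω, φ (w z') = φ (w z)) := by
  have hsub := hw.isSubharmonicOn hj.smooth hφ htame hconvex
  -- Interior points are included because the set where the maximum is attained must be shown open
  -- in all of `Ω`.
  have hlocal : ∀ z, w z ∈ U → IsLocalMax (φ ∘ w) z → ∀ᶠ z' in 𝓝 z, φ (w z') = φ (w z) := by
    intro z hzU hmax
    obtain ⟨e, hz, he⟩ := hj.exists_chart z
    exact ContactInstanton.eventually_eq_of_isLocalMax (hφ.comp hw.smooth) he hz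
      ((hU.preimage hw.smooth.continuous).mem_nhds hzU) hsub
      (fun q hq hqb hqs a ha => hw.differential_comp_eq_zero hφ hι htriple
        (he.mem_maximalAtlas (by simp)) hqs hqb hq ha) hmax
  refine ⟨hsub, fun z hzb hzU v hv => ?_, fun z _ hzU hmax => hlocal z hzU hmax,
    fun Ω hΩ hconn hΩU z hz hmax z' hz' => ?_⟩
  · have he := IsManifold.chart_mem_maximalAtlas (I := 𝓡∂ 2) (n := 1) z
    have h := hw.differential_comp_eq_zero hφ hι htriple he (mem_chart_source _ z) hzb hzU
      (a := ContactInstanton.chartCoord (𝓡∂ 2) (chartAt (EuclideanHalfSpace 2) z) z v) hv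
    rwa [ContactInstanton.chartVec_chartCoord he (mem_chart_source _ z)] at h
  · have hcont : Continuous (φ ∘ w) := hφ.continuous.comp hw.smooth.continuous
    have hopen : IsOpen {x | x ∈ Ω ∧ φ (w x) = φ (w z)} := by
      rw [isOpen_iff_mem_nhds]
      rintro x ⟨hx, hxz⟩
      have hxmax : IsLocalMax (φ ∘ w) x := by
        filter_upwards [hΩ.mem_nhds hx] with y hy
        exact (hmax y hy).trans_eq hxz.symm
      filter_upwards [hΩ.mem_nhds hx, hlocal x (hΩU hx) hxmax] with y hy hyx
      exact ⟨hy, hyx.trans hxz⟩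
    -- Within `Ω` the maximum set is open by `hlocal` and its complement is open by continuity, so
    -- preconnectedness excludes a point outside it.
    by_contra hne
    obtain ⟨y, -, hy1, hy2⟩ := hconn _ {x | φ (w x) ≠ φ (w z)} hopen
      (isOpen_ne_fun hcont continuous_const)
      (fun x hx => (em (φ (w x) = φ (w z))).imp (fun h => ⟨hx, h⟩) fun h => h)
      ⟨z, hz.1, hz.1, rfl⟩ ⟨z', hz', hne⟩
    exact hy2 hy1.2
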